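/- Let $d\ge 2$. Let $\Sigma\subset\mathbb R^d$ be a bounded hypersurface defined by a ($C^1$-)diffeomorphism $\alpha:\Sigma\to\widehat\Sigma$ onto a Lipschitz domain $\widehat\Sigma\subset\mathbb R^{d-1}$, where $\alpha$ and $\alpha^{-1}$ are Lipschitz continuous (as is the case when $\alpha$ extends to a diffeomorphism of the closures), and let $\gamma=\partial\Sigma=\overline\Sigma\setminus\Sigma$ be its boundary. Measurability, integrability and "almost everywhere" on $\Sigma$ refer to Lebesgue measure on $\widehat\Sigma$ via $\alpha$. Let $b:\Sigma\to\mathbb R$ satisfy: - A1: $b$ is a weight on $\Sigma$, i.e. $b\circ\alpha^{-1}=\widehat b|_{\widehat\Sigma}$ for some $\widehat b\in L^1_{\mathrm{loc}}(\mathbb R^{d-1})$ with $\widehat b>0$ almost everywhere. - A2: there are a constant $c>0$, a smooth cutoff function $\chi:\mathbb R^d\to[0,1]$ with $\chi=1$ in a neighbourhood of $\gamma$, and an integrable function $f$ on $\Sigma$, such that $b=c\,\bigl(\chi\,\mathrm{dist}(\cdot,\gamma)^{1/2}+(1-\chi)f\bigr)$ on $\Sigma$. - A3: $b$ is essentially bounded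 on $\Sigma$. - A4: there is a constant $a>0$ with $a\le f$ almost everywhere on $\Sigma$. For a weight $\omega$ on $\Sigma$ let $L^2_\omega(\Sigma)$ be the space of measurable $v$ on $\Sigma$ with $\|v\|_{0,\omega,\Sigma}^2=\int_{\widehat\Sigma}|v\circ\alpha^{-1}|^2\,(\omega\circ\alpha^{-1})\,dx<\infty$ (likewise for vector-valued $v$). Let $\nabla_\tau v$ be the weak tangential gradient of $v$, i.e. the tangential vector field on $\Sigma$ for which $\bigl(D(\alpha^{-1})\bigr)^{T}\,(\nabla_\tau v\circ\alpha^{-1})$ is the weak gradient of $v\circ\alpha^{-1}$ on $\widehat\Sigma$. Put $$H^1_b(\Sigma)=\{v\in L^2_{b^{-1}}(\Sigma)\mid \nabla_\tau v\in \mathbf L^2_b(\Sigma)\},\qquad \|v\|_{1,b,\Sigma}^2=\|v\|_{0,b^{-1},\Sigma}^2+\|\nabla_\tau v\|_{0,b,\Sigma}^2 ,$$ and let $C_0^\infty(\overline\Sigma)$ be the space of restrictions to $\Sigma$ of functions in $C_0^\infty(\mathbb R^d)$. Then $C_0^\infty(\overline\Sigma)\cap H^1_b(\Sigma)$ is dense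 in $H^1_b(\Sigma)$ with respect to $\|\cdot\|_{1,b,\Sigma}$: for every $v\in H^1_b(\Sigma)$ and every $\varepsilon>0$ there is $w\in C_0^\infty(\overline\Sigma)\cap H^1_b(\Sigma)$ with $\|v-w\|_{1,b,\Sigma}<\varepsilon$. -/

import Mathlib

open Set Filter Topology MeasureTheory
open scoped ContDiff NNReal

/-- The Euclidean space `ℝⁿ`. -/
abbrev Euc (n : ℕ) : Type := EuclideanSpace ℝ (Fin n)

/-- `T ⊆ ℝⁿ` is a Lipschitz domain: open, connected and nonempty, and near every boundary point it
is, in suitable Cartesian coordinates (height in direction `e`, the other coordinates in the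
hyperplane orthogonal to `e`), the set of points above the graph of a Lipschitz function `g`. -/
structure IsLipschitzDomain {n : ℕ} (T : Set (Euc n)) : Prop where
  isOpen : IsOpen T
  isConnected : IsConnected T
  local_graph : ∀ p ∈ frontier T, ∃ e : Euc n, ‖e‖ = 1 ∧
    ∃ (K : ℝ≥0) (g : (ℝ ∙ e)ᗮ → ℝ), LipschitzWith K g ∧
      ∀ᶠ x in 𝓝 p, x ∈ T ↔ g ((ℝ ∙ e)ᗮ.orthogonalProjectionOnto x) < inner ℝ e x

/-- The bijection `α` of `α.source ⊆ ℝⁿ⁺¹` onto the open set `α.target ⊆ ℝⁿ` is a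
`C¹`-diffeomorphism: `α⁻¹` is `C¹`, and `α` is locally the restriction of a `C¹` function of the
ambient space. -/
structure IsDiffeo {n : ℕ} (α : PartialEquiv (Euc (n + 1)) (Euc n)) : Prop where
  contDiffOn_symm : ContDiffOn ℝ 1 α.symm α.target
  exists_extension : ∀ s ∈ α.source, ∃ U ∈ 𝓝 s, ∃ g : Euc (n + 1) → Euc n,
    ContDiffOn ℝ 1 g U ∧ EqOn α g (U ∩ α.source)

/-- The bounded hypersurface `α.source ⊆ ℝⁿ⁺¹` is defined by the diffeomorphism `α` onto the
Lipschitz domain `α.target ⊆ ℝⁿ`; both `α` and `α⁻¹` are Lipschitz. -/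
structure IsBoundedHypersurface {n : ℕ} (α : PartialEquiv (Euc (n + 1)) (Euc n)) : Prop where
  isBounded : Bornology.IsBounded α.source
  lipschitzDomain : IsLipschitzDomain α.target
  isDiffeo : IsDiffeo α
  lipschitz : ∃ K : ℝ≥0, LipschitzOnWith K α α.source
  lipschitz_symm : ∃ K : ℝ≥0, LipschitzOnWith K α.symm α.target

/-- The boundary `γ = ∂Σ` of the hypersurface `Σ = α.source`. -/
def bdry {n : ℕ} (α : PartialEquiv (Euc (n + 1)) (Euc n)) : Set (Euc (n + 1)) :=
  closure α.source \ α.source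

/-- `w` is a weight on `ℝⁿ`: locally integrable and positive almost everywhere. -/
def IsWeight {n : ℕ} (w : Euc n → ℝ) : Prop :=
  LocallyIntegrable w ∧ ∀ᵐ x, 0 < w x

/-- `wt` is a weight on the hypersurface `α.source`. Only the values of `wt` on `α.source` matter. -/
def IsSurfaceWeight {n : ℕ} (α : PartialEquiv (Euc (n + 1)) (Euc n)) (wt : Euc (n + 1) → ℝ) :
    Prop :=
  ∃ w : Euc n → ℝ, IsWeight w ∧ EqOn w (wt ∘ α.symm) α.target

/-- The assumptions A1 to A4 on the fracture width `b`, with the cutoff function `χ` and the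
function `f`. Measures, and "almost everywhere", on the hypersurface are those of the chart. -/
structure WidthAssumptions {n : ℕ} (α : PartialEquiv (Euc (n + 1)) (Euc n))
    (b χ f : Euc (n + 1) → ℝ) : Prop where
  /-- A1 -/
  weight : IsSurfaceWeight α b
  /-- A2 -/
  cutoff_smooth : ContDiff ℝ ∞ χ
  cutoff_mem : ∀ x, χ x ∈ Icc (0 : ℝ) 1
  cutoff_eq_one : ∀ᶠ x in 𝓝ˢ (bdry α), χ x = 1
  integrable : IntegrableOn (f ∘ α.symm) α.target
  formula : ∃ c : ℝ, 0 < c ∧ ∀ s ∈ α.source,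
    b s = c * (χ s * Real.sqrt (Metric.infDist s (bdry α)) + (1 - χ s) * f s)
  /-- A3 -/
  bounded : ∃ bmax : ℝ, 0 < bmax ∧ ∀ᵐ x ∂(volume.restrict α.target), |b (α.symm x)| ≤ bmax
  /-- A4 -/
  lower_bound : ∃ a : ℝ, 0 < a ∧ ∀ᵐ x ∂(volume.restrict α.target), a ≤ f (α.symm x)

/-- `v ∈ L²_wt(Σ)`, for scalar or vector valued `v`: `v ∘ α⁻¹` is measurable and
`|v ∘ α⁻¹|² (wt ∘ α⁻¹)` is integrable on the parameter domain. -/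
def MemL2W {n : ℕ} {F : Type*} [NormedAddCommGroup F] (α : PartialEquiv (Euc (n + 1)) (Euc n))
    (wt : Euc (n + 1) → ℝ) (v : Euc (n + 1) → F) : Prop :=
  AEStronglyMeasurable (v ∘ α.symm) (volume.restrict α.target) ∧
    IntegrableOn (fun x => ‖v (α.symm x)‖ ^ 2 * wt (α.symm x)) α.target

/-- The squared norm `‖v‖²_{0,wt,Σ}`. -/
noncomputable def l2wNormSq {n : ℕ} {F : Type*} [NormedAddCommGroup F]
    (α : PartialEquiv (Euc (n + 1)) (Euc n)) (wt : Euc (n + 1) → ℝ) (v : Euc (n + 1) → F) : ℝ :=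
  ∫ x in α.target, ‖v (α.symm x)‖ ^ 2 * wt (α.symm x)

/-- `G` is the weak gradient of `u` on the open set `T ⊆ ℝⁿ`. -/
structure HasWeakGradientOn {n : ℕ} (T : Set (Euc n)) (u : Euc n → ℝ) (G : Euc n → Euc n) :
    Prop where
  locallyIntegrableOn : LocallyIntegrableOn u T
  locallyIntegrableOn_gradient : LocallyIntegrableOn G T
  integral_eq : ∀ φ : Euc n → ℝ, ContDiff ℝ ∞ φ → HasCompactSupport φ → tsupport φ ⊆ T →
    ∀ h : Euc n, ∫ x in T, u x * fderiv ℝ φ x h = - ∫ x in T, inner ℝ (G x) h * φ x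

/-- `W` is the weak tangential gradient of `v` on the hypersurface: it is tangential almost
everywhere, and the weak gradient of `v ∘ α⁻¹` is `D(α⁻¹)ᵀ (W ∘ α⁻¹)`, as the chain rule demands. -/
def HasWeakTangentialGradient {n : ℕ} (α : PartialEquiv (Euc (n + 1)) (Euc n))
    (v : Euc (n + 1) → ℝ) (W : Euc (n + 1) → Euc (n + 1)) : Prop :=
  (∀ᵐ x ∂(volume.restrict α.target), W (α.symm x) ∈ (fderiv ℝ α.symm x).range) ∧
  HasWeakGradientOn α.target (v ∘ α.symm)
    (fun x => (fderiv ℝ α.symm x).adjoint (W (α.symm x)))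

open Classical in
/-- The weak tangential gradient `∇_τ v`, unique up to null sets (and `0` if there is none). -/
noncomputable def tangentialGradient {n : ℕ} (α : PartialEquiv (Euc (n + 1)) (Euc n))
    (v : Euc (n + 1) → ℝ) : Euc (n + 1) → Euc (n + 1) :=
  if h : ∃ W, HasWeakTangentialGradient α v W then h.choose else 0

/-- The space `H¹_b(Σ)`: functions `v` in `L²` with weight `b⁻¹`, with a weak tangential gradient
in `L²` with weight `b`. Only the values of `v` and `b` on `Σ = α.source` matter. -/
def H1b {n : ℕ} (α : PartialEquiv (Euc (n + 1)) (Euc n)) (b : Euc (n + 1) → ℝ) :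
    Set (Euc (n + 1) → ℝ) :=
  {v | MemL2W α b⁻¹ v ∧ (∃ W, HasWeakTangentialGradient α v W) ∧
    MemL2W α b (tangentialGradient α v)}

/-- The norm `‖v‖_{1,b,Σ}`. -/
noncomputable def h1bNorm {n : ℕ} (α : PartialEquiv (Euc (n + 1)) (Euc n))
    (b : Euc (n + 1) → ℝ) (v : Euc (n + 1) → ℝ) : ℝ :=
  Real.sqrt (l2wNormSq α b⁻¹ v + l2wNormSq α b (tangentialGradient α v))

/-- The space `C₀^∞` of the closure of `Σ = α.source`: restrictions to `Σ` of smooth compactly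
supported functions on the ambient space. -/
def smoothUpToBdry {n : ℕ} (α : PartialEquiv (Euc (n + 1)) (Euc n)) : Set (Euc (n + 1) → ℝ) :=
  {v | ∃ φ : Euc (n + 1) → ℝ, ContDiff ℝ ∞ φ ∧ HasCompactSupport φ ∧ EqOn v φ α.source}

/-!
Write `T` for the parameter domain `α.target`, `β` for the parametrization `α⁻¹` and `d` for the
distance to `∂T`. As `α` and `α⁻¹` are Lipschitz, distances to `γ` on the hypersurface are
comparable to distances to `∂T` in the chart, so that the assumptions on the width give `b ∘ β ≈
d^(1/2)` on `T` (`WidthAssumptions.exists_comparison`). Tangential gradients are comparable in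
norm to gradients in the chart. Hence it suffices to approximate a pair `(v, ∇v)` on `T`, with the
weights `d^(-1/2)` on functions and `d^(1/2)` on gradients, by the pairs `(φ ∘ β, ∇(φ ∘ β))`, for
smooth `φ` of compact support in the ambient space.

These pairs span a subspace of a Hilbert space, and a closed subspace is weakly closed. Therefore
a pair `(v, ∇v)` belongs to the closure as soon as there is a sequence in it that is bounded in
the weighted norm and whose functions converge to `v` in the sense of distributions
(`PairMem.of_tendsto`); strong convergence of gradients never has to be shown. This is used twice.

* Smooth functions `w` on `ℝⁿ` belong to the closure: `w ∘ α` is Lipschitz on the hypersurface and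
  extends to a Lipschitz function of the ambient space. The mollifications of the extension
  converge uniformly, their gradients are bounded, and bounded pairs have bounded weighted norm
  because `d^(-1/2)` is integrable over a bounded Lipschitz domain
  (`IsBoundedHypersurface.pairMem_of_smooth`).

* A general `v` is reduced to smooth functions near a point of the closure of `T` in two steps,
  cutoff and mollification (`PairMem.smooth_mul_of_coneCondition`). The mollifier is shifted into
  the interior cone at that point. As moving into the cone does not decrease `d` essentially, the
  mollification is bounded on gradients in the norm with weight `d^(1/2)`. For the functions the
  weight `d^(-1/2)` has the wrong monotonicity; instead, the mollified functions are truncated at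
  height `M`, so that their weighted norm converges by dominated convergence for fixed `M`. A
  diagonal sequence with `M → ∞` is bounded and converges to the cut off `v`. The local statements
  are glued by compactness of the closure of `T` (`PairMem.of_forall_smooth`).
-/

open scoped Gradient ENNReal Convolution

/-! ### Calculus of weak gradients -/

section WeakGradient

variable {n : ℕ} {T : Set (Euc n)} {u : Euc n → ℝ} {G : Euc n → Euc n}

theorem MeasureTheory.LocallyIntegrableOn.integrable_smul_of_tsupport_subset {F : Type*}
    [NormedAddCommGroup F] [NormedSpace ℝ F] {u : Euc n → F} {φ : Euc n → ℝ}
    (hu : LocallyIntegrableOn u T) (hφ : Continuous φ) (hc : HasCompactSupport φ)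
    (hs : tsupport φ ⊆ T) : Integrable (fun x => φ x • u x) := by
  have h : IntegrableOn (fun x => φ x • u x) (tsupport φ) :=
    (hu.integrableOn_compact_subset hs hc).continuousOn_smul hφ.continuousOn hc
  refine (integrableOn_iff_integrable_of_support_subset ?_).1 h
  intro x hx
  refine subset_tsupport φ ?_
  intro h0
  exact hx (by simp [h0])

theorem setIntegral_eq_of_tsupport_subset {F : Type*} [NormedAddCommGroup F] [NormedSpace ℝ F]
    {φ : Euc n → ℝ} {g : Euc n → F} (hs : tsupport φ ⊆ T) (hg : ∀ x, x ∉ tsupport φ → g x = 0) :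
    ∫ x in T, g x = ∫ x, g x :=
  setIntegral_eq_integral_of_forall_compl_eq_zero fun x hx => hg x fun h => hx (hs h)

theorem fderiv_apply_eq_zero_of_notMem_tsupport {E F : Type*} [NormedAddCommGroup E]
    [NormedSpace ℝ E] [NormedAddCommGroup F] [NormedSpace ℝ F] {φ : E → F} {x : E}
    (hx : x ∉ tsupport φ) : fderiv ℝ φ x = 0 := by
  by_contra h
  exact hx (support_fderiv_subset ℝ h)

theorem inner_gradient_eq_fderiv {φ : Euc n → ℝ} (x h : Euc n) :
    inner ℝ (∇ φ x) h = fderiv ℝ φ x h := by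
  simp [gradient]

theorem norm_gradient_eq {φ : Euc n → ℝ} (x : Euc n) : ‖∇ φ x‖ = ‖fderiv ℝ φ x‖ := by
  simp [gradient]

theorem ContDiff.continuous_gradient {φ : Euc n → ℝ} (hφ : ContDiff ℝ ∞ φ) :
    Continuous (∇ φ) :=
  (InnerProductSpace.toDual ℝ (Euc n)).symm.continuous.comp
    (hφ.continuous_fderiv (by simp))

/-- A weak gradient is determined up to null sets. -/
theorem HasWeakGradientOn.ae_eq {G' : Euc n → Euc n} (hT : IsOpen T)
    (h : HasWeakGradientOn T u G) (h' : HasWeakGradientOn T u G') :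
    G =ᵐ[volume.restrict T] G' := by
  have key : ∀ᵐ x, x ∈ T → (G - G') x = 0 := by
    refine hT.ae_eq_zero_of_integral_contDiff_smul_eq_zero
      (h.locallyIntegrableOn_gradient.sub h'.locallyIntegrableOn_gradient) ?_
    intro φ hφ hc hs
    have hi := h.locallyIntegrableOn_gradient.integrable_smul_of_tsupport_subset
      hφ.continuous hc hs
    have hi' := h'.locallyIntegrableOn_gradient.integrable_smul_of_tsupport_subset
      hφ.continuous hc hs
    refine ext_inner_right ℝ fun a => ?_
    have e1 := h.integral_eq φ hφ hc hs a
    have e2 := h'.integral_eq φ hφ hc hs a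
    have aux : ∀ (K : Euc n → Euc n), Integrable (fun x => φ x • K x) →
        ∫ x in T, inner ℝ (K x) a * φ x = inner ℝ (∫ x, φ x • K x) a := by
      intro K hK
      rw [real_inner_comm, ← integral_inner hK, setIntegral_eq_of_tsupport_subset hs]
      · refine integral_congr_ae (Eventually.of_forall fun x => ?_)
        simp only [real_inner_smul_right]
        rw [real_inner_comm, mul_comm]
      · intro x hx
        simp [image_eq_zero_of_notMem_tsupport hx]
    rw [aux _ hi] at e1
    rw [aux _ hi'] at e2
    simp only [Pi.sub_apply, smul_sub]
    rw [integral_sub hi hi', inner_sub_left, inner_zero_left]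
    linarith
  rw [EventuallyEq, ae_restrict_iff' hT.measurableSet]
  filter_upwards [key] with x hx hxT
  simpa [sub_eq_zero] using hx hxT

/-- The classical gradient of a `C¹` function is its weak gradient. -/
theorem HasWeakGradientOn.of_contDiffOn (hT : IsOpen T) (hu : ContDiffOn ℝ 1 u T) :
    HasWeakGradientOn T u (∇ u) := by
  have hcu : ContinuousOn u T := hu.continuousOn
  have hcf : ContinuousOn (fderiv ℝ u) T := hu.continuousOn_fderiv_of_isOpen hT le_rfl
  have hcg : ContinuousOn (∇ u) T :=
    (InnerProductSpace.toDual ℝ (Euc n)).symm.continuous.comp_continuousOn hcf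
  have hlu := hcu.locallyIntegrableOn (μ := volume) hT.measurableSet
  have hlg := hcg.locallyIntegrableOn (μ := volume) hT.measurableSet
  refine ⟨hlu, hlg, ?_⟩
  intro φ hφ hc hs h
  have hdiff : ∀ x ∈ T, DifferentiableAt ℝ u x := fun x hx =>
    (hu.differentiableOn (by simp)).differentiableAt (hT.mem_nhds hx)
  have hφd : Differentiable ℝ φ := hφ.differentiable (by simp)
  have hc' : HasCompactSupport (fun x => fderiv ℝ φ x h) := hc.fderiv_apply ℝ h
  have hcont' : Continuous (fun x => fderiv ℝ φ x h) :=
    (hφ.continuous_fderiv (by simp)).clm_apply continuous_const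
  have hs' : tsupport (fun x => fderiv ℝ φ x h) ⊆ T :=
    (tsupport_fderiv_apply_subset ℝ h).trans hs
  have hlf : LocallyIntegrableOn (fun x => fderiv ℝ u x h) T :=
    ContinuousOn.locallyIntegrableOn (hcf.clm_apply continuousOn_const) hT.measurableSet
  have key := integral_mul_fderiv_eq_neg_fderiv_mul_of_integrable (μ := volume) (f := u) (g := φ)
    (v := h) ?_ ?_ ?_ (fun x hx => hdiff x (hs hx)) (fun x _ => hφd x)
  · rw [setIntegral_eq_of_tsupport_subset hs, setIntegral_eq_of_tsupport_subset hs, key]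
    · simp only [inner_gradient_eq_fderiv]
    · intro x hx
      simp [image_eq_zero_of_notMem_tsupport hx]
    · intro x hx
      simp [fderiv_apply_eq_zero_of_notMem_tsupport hx]
  · simpa [mul_comm] using hlf.integrable_smul_of_tsupport_subset hφ.continuous hc hs
  · simpa [mul_comm] using hlu.integrable_smul_of_tsupport_subset hcont' hc' hs'
  · simpa [mul_comm] using hlu.integrable_smul_of_tsupport_subset hφ.continuous hc hs

/-- Leibniz rule for the product of a weakly differentiable and a smooth function. -/
theorem HasWeakGradientOn.smooth_mul {θ : Euc n → ℝ} (hT : IsOpen T)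
    (h : HasWeakGradientOn T u G) (hθ : ContDiff ℝ ∞ θ) :
    HasWeakGradientOn T (fun x => θ x * u x) (fun x => θ x • G x + u x • ∇ θ x) := by
  have hu := h.locallyIntegrableOn
  have hG := h.locallyIntegrableOn_gradient
  have hlc : IsLocallyClosed T := hT.isLocallyClosed
  refine ⟨hu.continuousOn_mul hθ.continuous.continuousOn hlc,
    (hG.continuousOn_smul hlc hθ.continuous.continuousOn).add
      (hu.smul_continuousOn hlc hθ.continuous_gradient.continuousOn), ?_⟩
  intro φ hφ hc hs a
  have hθd : Differentiable ℝ θ := hθ.differentiable (by simp)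
  have hφd : Differentiable ℝ φ := hφ.differentiable (by simp)
  have hs' : tsupport (fun x => θ x * φ x) ⊆ T := (tsupport_mul_subset_right).trans hs
  have e := h.integral_eq (fun x => θ x * φ x) (hθ.mul hφ) hc.mul_left hs' a
  have hder : ∀ x, fderiv ℝ (fun x => θ x * φ x) x a
      = θ x * fderiv ℝ φ x a + φ x * fderiv ℝ θ x a := by
    intro x
    rw [fderiv_fun_mul (hθd x) (hφd x)]
    simp
  simp only [hder] at e
  have hcφ' : Continuous (fun x => fderiv ℝ φ x a) :=
    (hφ.continuous_fderiv (by simp)).clm_apply continuous_const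
  have hcθ' : Continuous (fun x => fderiv ℝ θ x a) :=
    (hθ.continuous_fderiv (by simp)).clm_apply continuous_const
  have i1 : Integrable (fun x => (θ x * fderiv ℝ φ x a) • u x) :=
    hu.integrable_smul_of_tsupport_subset (hθ.continuous.mul hcφ') (hc.fderiv_apply ℝ a).mul_left
      ((tsupport_mul_subset_right).trans ((tsupport_fderiv_apply_subset ℝ a).trans hs))
  have i2 : Integrable (fun x => (φ x * fderiv ℝ θ x a) • u x) :=
    hu.integrable_smul_of_tsupport_subset (hφ.continuous.mul hcθ') hc.mul_right
      ((tsupport_mul_subset_left).trans hs)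
  have i3 : Integrable (fun x => (θ x * φ x) • G x) :=
    hG.integrable_smul_of_tsupport_subset (hθ.continuous.mul hφ.continuous) hc.mul_left hs'
  have i3' : Integrable (fun x => inner ℝ (G x) a * (θ x * φ x)) := by
    have := i3.inner_const (𝕜 := ℝ) a
    refine this.congr (Eventually.of_forall fun x => ?_)
    simp only [real_inner_smul_left]
    ring
  have e1 : ∫ x in T, u x * (θ x * fderiv ℝ φ x a + φ x * fderiv ℝ θ x a)
      = (∫ x in T, θ x * u x * fderiv ℝ φ x a) + ∫ x in T, (φ x * fderiv ℝ θ x a) • u x := by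
    rw [← integral_add]
    · refine integral_congr_ae (Eventually.of_forall fun x => ?_)
      simp only [smul_eq_mul]; ring
    · refine (i1.congr (Eventually.of_forall fun x => ?_)).integrableOn
      simp only [smul_eq_mul]; ring
    · exact i2.integrableOn
  have e2 : ∫ x in T, inner ℝ (θ x • G x + u x • ∇ θ x) a * φ x
      = (∫ x in T, inner ℝ (G x) a * (θ x * φ x)) + ∫ x in T, (φ x * fderiv ℝ θ x a) • u x := by
    rw [← integral_add i3'.integrableOn i2.integrableOn]
    refine integral_congr_ae (Eventually.of_forall fun x => ?_)
    simp only [smul_eq_mul, inner_add_left, real_inner_smul_left, inner_gradient_eq_fderiv]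
    ring
  rw [e2]
  rw [e1] at e
  linarith

theorem HasWeakGradientOn.congr {u' : Euc n → ℝ} {G' : Euc n → Euc n} (hT : MeasurableSet T)
    (h : HasWeakGradientOn T u G) (hu : EqOn u' u T) (hG : G' =ᵐ[volume.restrict T] G) :
    HasWeakGradientOn T u' G' := by
  have hu' : u =ᵐ[volume.restrict T] u' := by
    filter_upwards [ae_restrict_mem hT] with x hx using (hu hx).symm
  refine ⟨fun x hx => ?_, fun x hx => ?_, ?_⟩
  · obtain ⟨s, hs, hi⟩ := h.locallyIntegrableOn x hx
    refine ⟨s ∩ T, inter_mem hs self_mem_nhdsWithin, ?_⟩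
    exact (hi.mono_set inter_subset_left).congr_fun_ae
      (hu'.filter_mono (ae_mono (Measure.restrict_mono inter_subset_right le_rfl)))
  · obtain ⟨s, hs, hi⟩ := h.locallyIntegrableOn_gradient x hx
    refine ⟨s ∩ T, inter_mem hs self_mem_nhdsWithin, ?_⟩
    exact (hi.mono_set inter_subset_left).congr_fun_ae
      (hG.symm.filter_mono (ae_mono (Measure.restrict_mono inter_subset_right le_rfl)))
  · intro φ hφ hc hs a
    have e := h.integral_eq φ hφ hc hs a
    rw [integral_congr_ae (g := fun x => u x * fderiv ℝ φ x a),
      integral_congr_ae (f := fun x => inner ℝ (G' x) a * φ x)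
        (g := fun x => inner ℝ (G x) a * φ x)]
    · exact e
    · filter_upwards [hG] with x hx
      rw [hx]
    · filter_upwards [hu'] with x hx
      rw [hx]

theorem HasWeakGradientOn.integrable_mul_fderiv {φ : Euc n → ℝ}
    (h : HasWeakGradientOn T u G) (hφ : ContDiff ℝ ∞ φ) (hc : HasCompactSupport φ)
    (hs : tsupport φ ⊆ T) (a : Euc n) : Integrable (fun x => u x * fderiv ℝ φ x a) := by
  have := h.locallyIntegrableOn.integrable_smul_of_tsupport_subset
    ((hφ.continuous_fderiv (by simp)).clm_apply (continuous_const (y := a)))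
    (hc.fderiv_apply ℝ a) ((tsupport_fderiv_apply_subset ℝ a).trans hs)
  simpa [mul_comm] using this

theorem HasWeakGradientOn.integrable_inner_mul {φ : Euc n → ℝ}
    (h : HasWeakGradientOn T u G) (hφ : ContDiff ℝ ∞ φ) (hc : HasCompactSupport φ)
    (hs : tsupport φ ⊆ T) (a : Euc n) : Integrable (fun x => inner ℝ (G x) a * φ x) := by
  have := (h.locallyIntegrableOn_gradient.integrable_smul_of_tsupport_subset
    hφ.continuous hc hs).inner_const (𝕜 := ℝ) a
  refine this.congr (Eventually.of_forall fun x => ?_)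
  simp only [real_inner_smul_left]
  ring

theorem HasWeakGradientOn.sub {u' : Euc n → ℝ} {G' : Euc n → Euc n}
    (h : HasWeakGradientOn T u G) (h' : HasWeakGradientOn T u' G') :
    HasWeakGradientOn T (fun x => u x - u' x) (fun x => G x - G' x) := by
  refine ⟨h.locallyIntegrableOn.sub h'.locallyIntegrableOn,
    h.locallyIntegrableOn_gradient.sub h'.locallyIntegrableOn_gradient, ?_⟩
  intro φ hφ hc hs a
  have e := h.integral_eq φ hφ hc hs a
  have e' := h'.integral_eq φ hφ hc hs a
  simp only [sub_mul, inner_sub_left]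
  rw [integral_sub (h.integrable_mul_fderiv hφ hc hs a).integrableOn
      (h'.integrable_mul_fderiv hφ hc hs a).integrableOn,
    integral_sub (h.integrable_inner_mul hφ hc hs a).integrableOn
      (h'.integrable_inner_mul hφ hc hs a).integrableOn]
  linarith

end WeakGradient

/-! ### Cones and the distance to the boundary in a Lipschitz domain -/

section Geometry

variable {n : ℕ} {T : Set (Euc n)}

/-- The uniform interior cone condition at `p`, with axis `e`, size `r` and opening `κ`: from every
point of `T` near `p` the truncated cone spanned by the ball `ball e κ` stays in `T`. The axis may
be short, so that interior points satisfy the condition as well, with `e = 0`. -/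
def ConeCondition (T : Set (Euc n)) (p e : Euc n) (r κ : ℝ) : Prop :=
  ‖e‖ ≤ 1 ∧ 0 < r ∧ 0 < κ ∧ κ ≤ 1 ∧
    ∀ x ∈ T, x ∈ Metric.ball p r → ∀ h : ℝ, 0 < h → h < r → ∀ z ∈ Metric.ball e κ, x + h • z ∈ T

theorem IsLipschitzDomain.exists_coneCondition (hT : IsLipschitzDomain T) {p : Euc n}
    (hp : p ∈ closure T) : ∃ e r κ, ConeCondition T p e r κ := by
  by_cases hpT : p ∈ T
  · obtain ⟨ρ, hρ, hsub⟩ := Metric.isOpen_iff.1 hT.isOpen p hpT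
    refine ⟨0, ρ / 2, 1, by simp, by positivity, one_pos, le_rfl, ?_⟩
    intro x _ hx h h0 hr z hz
    apply hsub
    rw [mem_ball_iff_norm] at hx hz ⊢
    rw [sub_zero] at hz
    have : ‖h • z‖ ≤ h := by
      rw [norm_smul, Real.norm_of_nonneg h0.le]
      nlinarith
    calc ‖x + h • z - p‖ = ‖(x - p) + h • z‖ := by congr 1; abel
      _ ≤ ‖x - p‖ + ‖h • z‖ := norm_add_le _ _
      _ < ρ := by linarith
  · have hpf : p ∈ frontier T := by
      rw [hT.isOpen.frontier_eq]; exact ⟨hp, hpT⟩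
    obtain ⟨e, he, K, g, hg, hev⟩ := hT.local_graph p hpf
    obtain ⟨ρ, hρ, hsub⟩ := Metric.eventually_nhds_iff_ball.1 hev
    have hK : (0 : ℝ) < 1 + K := by positivity
    -- the opening is chosen such that `κ (1 + K) < 1`
    have hκ0 : 0 < 1 / (2 * (1 + (K : ℝ))) := by positivity
    have hκ : (1 + (K : ℝ)) * (1 / (2 * (1 + (K : ℝ)))) = 1 / 2 := by field_simp
    set κ := 1 / (2 * (1 + (K : ℝ))) with hκdef
    have hκ1 : κ ≤ 1 := by nlinarith [K.coe_nonneg]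
    refine ⟨e, ρ / 3, κ, he.le, by positivity, hκ0, hκ1, ?_⟩
    intro x hxT hx h h0 hr z hz
    rw [mem_ball_iff_norm] at hx hz
    have hxb : x ∈ Metric.ball p ρ := by
      rw [mem_ball_iff_norm]; linarith
    have hz2 : ‖z‖ ≤ 2 := by
      calc ‖z‖ = ‖e + (z - e)‖ := by congr 1; abel
        _ ≤ ‖e‖ + ‖z - e‖ := norm_add_le _ _
        _ ≤ 2 := by linarith
    have hyb : x + h • z ∈ Metric.ball p ρ := by
      rw [mem_ball_iff_norm]
      have : ‖h • z‖ ≤ h * 2 := by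
        rw [norm_smul, Real.norm_of_nonneg h0.le]
        gcongr
      calc ‖x + h • z - p‖ = ‖(x - p) + h • z‖ := by congr 1; abel
        _ ≤ ‖x - p‖ + ‖h • z‖ := norm_add_le _ _
        _ < ρ := by linarith
    have h1 := (hsub x hxb).1 hxT
    refine (hsub _ hyb).2 ?_
    set P := (ℝ ∙ e)ᗮ.orthogonalProjectionOnto with hP
    have hPe : P e = 0 := by
      apply Submodule.orthogonalProjectionOnto_orthogonal_apply_eq_zero
      exact Submodule.mem_span_singleton_self e
    have hPz : ‖P z‖ ≤ κ := by
      have e1 : P z = P (z - e) := by rw [map_sub, hPe, sub_zero]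
      rw [e1]
      exact (Submodule.norm_orthogonalProjectionOnto_apply_le _ _).trans hz.le
    have hgle : g (P (x + h • z)) ≤ g (P x) + K * (h * κ) := by
      have := hg.dist_le_mul (P (x + h • z)) (P x)
      rw [Real.dist_eq, dist_eq_norm] at this
      have e2 : P (x + h • z) - P x = h • P z := by rw [map_add, map_smul]; abel
      rw [e2, norm_smul, Real.norm_of_nonneg h0.le] at this
      have h3 := (le_abs_self _).trans this
      have : (K : ℝ) * (h * ‖P z‖) ≤ K * (h * κ) := by gcongr
      linarith
    have hin : inner ℝ e (x + h • z) ≥ inner ℝ e x + h * (1 - κ) := by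
      have e3 : inner ℝ e z = 1 + inner ℝ e (z - e) := by
        rw [inner_sub_right, real_inner_self_eq_norm_sq, he]; ring
      have e4 : -κ ≤ inner ℝ e (z - e) := by
        have := abs_real_inner_le_norm e (z - e)
        rw [he, one_mul] at this
        linarith [(abs_le.1 this).1]
      rw [inner_add_right, real_inner_smul_right, e3]
      nlinarith
    nlinarith

theorem frontier_nonempty_of_isBounded (hn : 1 ≤ n) (hT : T.Nonempty)
    (hb : Bornology.IsBounded T) : (frontier T).Nonempty := by
  have : Nonempty (Fin n) := ⟨⟨0, hn⟩⟩
  refine nonempty_frontier_iff.2 ⟨hT, fun h => ?_⟩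
  rw [h] at hb
  exact NormedSpace.unbounded_univ ℝ (Euc n) hb

theorem infDist_frontier_pos (hT : IsOpen T) (hf : (frontier T).Nonempty) {x : Euc n}
    (hx : x ∈ T) : 0 < Metric.infDist x (frontier T) := by
  refine (isClosed_frontier.notMem_iff_infDist_pos hf).1 fun h => ?_
  rw [hT.frontier_eq] at h
  exact h.2 hx

theorem ball_infDist_frontier_subset (hT : IsOpen T) {x : Euc n} (hx : x ∈ T) :
    Metric.ball x (Metric.infDist x (frontier T)) ⊆ T := by
  by_cases hpos : 0 < Metric.infDist x (frontier T)
  swap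
  · rw [Metric.ball_eq_empty.2 (not_lt.1 hpos)]
    exact empty_subset _
  refine IsPreconnected.subset_left_of_subset_union hT (isClosed_closure (s := T)).isOpen_compl
    ?_ ?_ ⟨x, Metric.mem_ball_self hpos, hx⟩ (convex_ball x _).isPreconnected
  · exact disjoint_compl_right.mono_left subset_closure
  · intro y hy
    by_contra hcon
    simp only [mem_union, mem_compl_iff, not_or, not_not] at hcon
    have hyf : y ∈ frontier T := by
      rw [hT.frontier_eq]; exact ⟨hcon.2, hcon.1⟩
    have := Metric.infDist_le_dist_of_mem (x := x) hyf
    rw [Metric.mem_ball, dist_comm] at hy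
    linarith

variable {p e : Euc n} {r κ : ℝ}

/-- Moving into the cone does not decrease the distance to the boundary, up to truncation. -/
theorem ConeCondition.min_le_infDist (hc : ConeCondition T p e r κ) (hT : IsOpen T)
    (hf : (frontier T).Nonempty) {x : Euc n} (hx : x ∈ T) (hxp : x ∈ Metric.ball p (r / 2)) {h : ℝ}
    (h0 : 0 < h) (hr : h < r) {z : Euc n} (hz : z ∈ Metric.ball e κ) :
    min (Metric.infDist x (frontier T)) (r / 2) ≤ Metric.infDist (x + h • z) (frontier T) := by
  obtain ⟨-, -, -, -, hcone⟩ := hc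
  rw [Metric.le_infDist hf]
  intro y hy
  by_contra hlt
  push Not at hlt
  rw [lt_min_iff, dist_comm, dist_eq_norm] at hlt
  have hx' : y - h • z ∈ T := by
    apply ball_infDist_frontier_subset hT hx
    rw [mem_ball_iff_norm]
    have e1 : y - h • z - x = y - (x + h • z) := by abel
    rw [e1]; exact hlt.1
  have hxb : y - h • z ∈ Metric.ball p r := by
    rw [mem_ball_iff_norm] at hxp ⊢
    have e1 : y - h • z - p = (y - (x + h • z)) + (x - p) := by abel
    rw [e1]
    refine (norm_add_le _ _).trans_lt ?_
    linarith [hlt.2]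
  have := hcone _ hx' hxb h h0 hr z hz
  rw [sub_add_cancel] at this
  rw [hT.frontier_eq] at hy
  exact hy.2 this

theorem ConeCondition.mul_le_infDist (hc : ConeCondition T p e r κ) (hT : IsOpen T)
    (hf : (frontier T).Nonempty) {x : Euc n} (hx : x ∈ T) (hxp : x ∈ Metric.ball p r) {h : ℝ}
    (h0 : 0 < h) (hr : h < r) : κ * h ≤ Metric.infDist (x + h • e) (frontier T) := by
  obtain ⟨-, -, -, -, hcone⟩ := hc
  rw [Metric.le_infDist hf]
  intro y hy
  by_contra hlt
  push Not at hlt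
  rw [dist_comm, dist_eq_norm] at hlt
  have hz : h⁻¹ • (y - x) ∈ Metric.ball e κ := by
    rw [mem_ball_iff_norm]
    have e1 : h⁻¹ • (y - x) - e = h⁻¹ • (y - (x + h • e)) := by
      rw [← sub_sub, smul_sub h⁻¹ (y - x), smul_smul, inv_mul_cancel₀ h0.ne', one_smul]
    rw [e1, norm_smul, norm_inv, Real.norm_of_nonneg h0.le, inv_mul_lt_iff₀ h0, mul_comm]
    exact hlt
  have := hcone x hx hxp h h0 hr _ hz
  rw [smul_smul, mul_inv_cancel₀ h0.ne', one_smul, add_sub_cancel] at this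
  rw [hT.frontier_eq] at hy
  exact hy.2 this

theorem lintegral_inv_sqrt_lt_top (c ρ : ℝ) (hc : 0 < c) :
    ∫⁻ σ in Ico 0 ρ, (ENNReal.ofReal √(c * σ))⁻¹ < ⊤ := by
  have h1 : IntegrableOn (fun σ : ℝ => σ ^ (-(1 / 2) : ℝ)) (Ioo 0 ρ) := by
    by_cases hρ : 0 < ρ
    · exact (intervalIntegral.integrableOn_Ioo_rpow_iff hρ).2 (by norm_num)
    · rw [Ioo_eq_empty hρ]; exact integrableOn_empty
  have h2 : IntegrableOn (fun σ : ℝ => (√(c * σ))⁻¹) (Ioo 0 ρ) := by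
    refine IntegrableOn.congr_fun (Integrable.const_mul h1 (√c)⁻¹) (fun σ hσ => ?_)
      measurableSet_Ioo
    rw [Real.sqrt_mul hc.le, mul_inv, Real.sqrt_eq_rpow σ, ← Real.rpow_neg hσ.1.le]
  rw [← Measure.restrict_congr_set (Ioo_ae_eq_Ico (μ := volume) (a := (0 : ℝ)) (b := ρ))]
  refine lt_of_eq_of_lt ?_ h2.lintegral_lt_top
  refine setLIntegral_congr_fun measurableSet_Ioo fun σ hσ => ?_
  have : 0 < √(c * σ) := Real.sqrt_pos.2 (mul_pos hc hσ.1)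
  rw [ENNReal.ofReal_inv_of_pos this]

/-- Near a point with the cone condition, `dist(·, ∂T)^(-1/2)` is integrable: along each line in
the direction of the axis, the distance to the boundary grows at least linearly after entering `T`.
Averaging over translates along the axis replaces a choice of coordinates. -/
theorem ConeCondition.lintegral_inv_sqrt_infDist_lt_top (hc : ConeCondition T p e r κ)
    (hT : IsOpen T) (hf : (frontier T).Nonempty) :
    ∫⁻ x in T ∩ Metric.ball p (r / 2),
      (ENNReal.ofReal √(Metric.infDist x (frontier T)))⁻¹ < ⊤ := by
  have hc' := hc
  obtain ⟨he, hr, hκ, -, -⟩ := hc'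
  set ρ := r / 2 with hρ
  have hρ0 : 0 < ρ := by positivity
  set A := T ∩ Metric.ball p ρ with hA
  have hAm : MeasurableSet A := hT.measurableSet.inter Metric.isOpen_ball.measurableSet
  set w : Euc n → ℝ≥0∞ := fun x => (ENNReal.ofReal √(Metric.infDist x (frontier T)))⁻¹ with hw
  have hwm : Measurable w :=
    (ENNReal.measurable_ofReal.comp
      (Real.continuous_sqrt.comp (Metric.continuous_infDist_pt _)).measurable).inv
  set F : Euc n → ℝ≥0∞ := A.indicator w with hF
  have hFm : Measurable F := hwm.indicator hAm
  set C : ℝ≥0∞ := ∫⁻ σ in Ico 0 ρ, (ENNReal.ofReal √(κ * σ))⁻¹ with hC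
  have hCfin : C < ⊤ := lintegral_inv_sqrt_lt_top κ ρ hκ
  have hinner : ∀ x, ∫⁻ s in Ioo 0 ρ, F (x + s • e)
      ≤ (Metric.ball p (2 * ρ)).indicator (fun _ => C) x := by
    intro x
    by_cases hx : x ∈ Metric.ball p (2 * ρ)
    swap
    · rw [indicator_of_notMem hx, nonpos_iff_eq_zero]
      refine (setLIntegral_congr_fun measurableSet_Ioo (g := fun _ => 0) fun s hs => ?_).trans
        (by simp)
      apply indicator_of_notMem
      rintro ⟨-, hmem⟩
      apply hx
      rw [mem_ball_iff_norm] at hmem ⊢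
      have e1 : x - p = (x + s • e - p) - s • e := by abel
      have e2 : ‖s • e‖ ≤ s := by
        rw [norm_smul, Real.norm_of_nonneg hs.1.le]
        exact mul_le_of_le_one_right hs.1.le he
      rw [e1]
      refine (norm_sub_le _ _).trans_lt ?_
      linarith [hs.2]
    rw [indicator_of_mem hx]
    set B : Set ℝ := {s | s ∈ Ioo 0 ρ ∧ x + s • e ∈ A} with hB
    have hBb : BddBelow B := ⟨0, fun s hs => hs.1.1.le⟩
    -- `sInf B` is the parameter at which the line enters `T`
    have hbound : ∀ s ∈ Ioo 0 ρ, F (x + s • e) ≤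
        (Ico 0 ρ).indicator (fun σ => (ENNReal.ofReal √(κ * σ))⁻¹) (s - sInf B) := by
      intro s hs
      by_cases hsA : x + s • e ∈ A
      swap
      · rw [hF, indicator_of_notMem hsA]; exact zero_le
      have hsB : s ∈ B := ⟨hs, hsA⟩
      have h1 : sInf B ≤ s := csInf_le hBb hsB
      have h2 : 0 ≤ sInf B := le_csInf ⟨s, hsB⟩ fun t ht => ht.1.1.le
      rw [hF, indicator_of_mem hsA,
        indicator_of_mem (show s - sInf B ∈ Ico 0 ρ from ⟨by linarith, by linarith [hs.2]⟩)]
      have hd : κ * (s - sInf B) ≤ Metric.infDist (x + s • e) (frontier T) := by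
        have : s - Metric.infDist (x + s • e) (frontier T) / κ ≤ sInf B := by
          refine le_csInf ⟨s, hsB⟩ fun t ht => ?_
          rcases lt_or_ge t s with hts | hts
          · have h3 := hc.mul_le_infDist hT hf (x := x + t • e) ht.2.1
              (Metric.ball_subset_ball (by linarith) ht.2.2) (h := s - t) (by linarith)
              (by linarith [hs.2, ht.1.1])
            have e1 : x + t • e + (s - t) • e = x + s • e := by
              rw [add_assoc, ← add_smul]; congr 2; ring
            rw [e1] at h3
            have h4 : s - t ≤ Metric.infDist (x + s • e) (frontier T) / κ := by
              rw [le_div_iff₀ hκ]; linarith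
            linarith
          · have : 0 ≤ Metric.infDist (x + s • e) (frontier T) / κ :=
              div_nonneg Metric.infDist_nonneg hκ.le
            linarith
        have h5 : s - sInf B ≤ Metric.infDist (x + s • e) (frontier T) / κ := by linarith
        rw [le_div_iff₀ hκ] at h5
        linarith
      exact ENNReal.inv_le_inv.2 (ENNReal.ofReal_le_ofReal (Real.sqrt_le_sqrt hd))
    calc ∫⁻ s in Ioo 0 ρ, F (x + s • e)
        ≤ ∫⁻ s in Ioo 0 ρ,
          (Ico 0 ρ).indicator (fun σ => (ENNReal.ofReal √(κ * σ))⁻¹) (s - sInf B) :=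
          setLIntegral_mono' measurableSet_Ioo hbound
      _ ≤ ∫⁻ s, (Ico 0 ρ).indicator (fun σ => (ENNReal.ofReal √(κ * σ))⁻¹) (s - sInf B) :=
          setLIntegral_le_lintegral _ _
      _ = ∫⁻ s, (Ico 0 ρ).indicator (fun σ => (ENNReal.ofReal √(κ * σ))⁻¹) s :=
          lintegral_sub_right_eq_self _ _
      _ = C := lintegral_indicator measurableSet_Ico _
  have key : ENNReal.ofReal ρ * ∫⁻ x, F x ≤ C * volume (Metric.ball p (2 * ρ)) := by
    calc ENNReal.ofReal ρ * ∫⁻ x, F x = ∫⁻ s in Ioo 0 ρ, ∫⁻ x, F (x + s • e) := by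
          simp only [lintegral_add_right_eq_self]
          rw [setLIntegral_const, Real.volume_Ioo, sub_zero, mul_comm]
      _ = ∫⁻ x, ∫⁻ s in Ioo 0 ρ, F (x + s • e) := by
          refine lintegral_lintegral_swap (Measurable.aemeasurable ?_)
          exact hFm.comp (by fun_prop)
      _ ≤ ∫⁻ x, (Metric.ball p (2 * ρ)).indicator (fun _ => C) x := lintegral_mono hinner
      _ = C * volume (Metric.ball p (2 * ρ)) := by
          rw [lintegral_indicator Metric.isOpen_ball.measurableSet, setLIntegral_const]
  have hfin : ENNReal.ofReal ρ * ∫⁻ x, F x < ⊤ :=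
    key.trans_lt (ENNReal.mul_lt_top hCfin Metric.isBounded_ball.measure_lt_top)
  rw [← lintegral_indicator hAm]
  exact ENNReal.lt_top_of_mul_ne_top_right hfin.ne (by simpa using hρ0)

/-- On a bounded Lipschitz domain the function `dist(·, ∂T)^(-1/2)` is integrable. -/
theorem IsLipschitzDomain.integrableOn_inv_sqrt_infDist (hT : IsLipschitzDomain T)
    (hb : Bornology.IsBounded T) (hf : (frontier T).Nonempty) :
    IntegrableOn (fun x => (√(Metric.infDist x (frontier T)))⁻¹) T := by
  have hfin : ∫⁻ x in T ∩ closure T,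
      (ENNReal.ofReal √(Metric.infDist x (frontier T)))⁻¹ < ⊤ := by
    refine IsCompact.induction_on (s := closure T) hb.isCompact_closure
      (p := fun s => ∫⁻ x in T ∩ s, (ENNReal.ofReal √(Metric.infDist x (frontier T)))⁻¹ < ⊤)
      (by simp) ?_ ?_ ?_
    · intro s t hst ht
      exact (lintegral_mono_set (inter_subset_inter_right _ hst)).trans_lt ht
    · intro s t hs ht
      rw [inter_union_distrib_left]
      exact (lintegral_union_le _ _ _).trans_lt (ENNReal.add_lt_top.2 ⟨hs, ht⟩)
    · intro p hp
      obtain ⟨e, r, κ, hc⟩ := hT.exists_coneCondition hp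
      exact ⟨_, mem_nhdsWithin_of_mem_nhds (Metric.ball_mem_nhds p (half_pos hc.2.1)),
        hc.lintegral_inv_sqrt_infDist_lt_top hT.isOpen hf⟩
  rw [inter_eq_left.2 subset_closure] at hfin
  refine ⟨?_, ?_⟩
  · exact (Real.continuous_sqrt.comp
      (Metric.continuous_infDist_pt (frontier T))).measurable.inv.aestronglyMeasurable
  · rw [hasFiniteIntegral_iff_ofReal]
    · refine lt_of_eq_of_lt (setLIntegral_congr_fun hT.isOpen.measurableSet fun x hx => ?_) hfin
      exact ENNReal.ofReal_inv_of_pos (Real.sqrt_pos.2 (infDist_frontier_pos hT.isOpen hf hx))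
    · exact Eventually.of_forall fun x => by positivity

end Geometry

/-! ### Mollification with shifted kernels -/

section Mollification

/-- Lebesgue differentiation for mollifiers whose centres may move off the origin, as long as the
shift is comparable to the radius. -/
theorem ContDiffBump.ae_convolution_tendsto_of_norm_center_le {n : ℕ} {ι : Type*} {l : Filter ι}
    {c : ι → Euc n} {φ : ∀ i, ContDiffBump (c i)} {K K' : ℝ} {g : Euc n → ℝ}
    (hφ : Tendsto (fun i => (φ i).rOut) l (𝓝 0)) (hK : ∀ i, (φ i).rOut ≤ K * (φ i).rIn)
    (hc : ∀ i, ‖c i‖ ≤ K' * (φ i).rOut) (hg : LocallyIntegrable g) :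
    ∀ᵐ x, Tendsto (fun i => ((φ i).normed volume ⋆[ContinuousLinearMap.lsmul ℝ ℝ, volume] g) x) l
      (𝓝 (g x)) := by
  filter_upwards [IsUnifLocDoublingMeasure.ae_tendsto_average_norm_sub volume hg K'] with x hx
  have hφ' : Tendsto (fun i ↦ (φ i).rOut) l (𝓝[>] 0) :=
    tendsto_nhdsWithin_iff.2 ⟨hφ, Eventually.of_forall (fun i ↦ (φ i).rOut_pos)⟩
  have h0 := hx (fun i => x - c i) (fun i => (φ i).rOut) hφ' (Eventually.of_forall fun i => by
    rw [mem_closedBall_iff_norm]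
    simpa using hc i)
  simp only [convolution_eq_swap, ContinuousLinearMap.lsmul_apply]
  apply tendsto_integral_smul_of_tendsto_average_norm_sub (K ^ (Module.finrank ℝ (Euc n))) h0
  · filter_upwards with i using
      hg.integrableOn_isCompact (isCompact_closedBall _ _)
  · apply tendsto_const_nhds.congr (fun i ↦ ?_)
    rw [integral_sub_left_eq_self (fun y => (φ i).normed volume y) volume x,
      ContDiffBump.integral_normed]
  · filter_upwards with i
    intro y hy
    have : x - y ∈ Function.support ((φ i).normed volume) := hy
    rw [ContDiffBump.support_normed_eq, mem_ball_iff_norm] at this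
    rw [mem_closedBall_iff_norm, ← norm_neg]
    refine le_of_eq_of_le ?_ this.le
    congr 1; abel
  · filter_upwards with i y
    rw [abs_of_nonneg (ContDiffBump.nonneg_normed _ _), Measure.addHaar_real_closedBall_center,
      ← Measure.addHaar_real_closedBall_center volume (c i)]
    exact (φ i).normed_le_div_measure_closedBall_rOut _ _ (hK i) _

variable {n : ℕ} {T : Set (Euc n)} {u : Euc n → ℝ} {G : Euc n → Euc n} {c : Euc n}

theorem ContDiffBump.contDiff_normed_convolution (φ : ContDiffBump c) {g : Euc n → ℝ}
    (hg : LocallyIntegrable g) :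
    ContDiff ℝ ∞ (φ.normed volume ⋆[ContinuousLinearMap.lsmul ℝ ℝ, volume] g) :=
  φ.hasCompactSupport_normed.contDiff_convolution_left _ φ.contDiff_normed hg

/-- The gradient of a mollified function is the mollified weak gradient, at those points where the
mollifier only sees the open set on which the weak gradient is given. -/
theorem ContDiffBump.gradient_convolution_indicator (φ : ContDiffBump c)
    (hu : HasWeakGradientOn T u G) (hT : IsOpen T)
    (hi : LocallyIntegrable (T.indicator u)) {x : Euc n}
    (hx : Metric.closedBall (x - c) φ.rOut ⊆ T) :
    ∇ (φ.normed volume ⋆[ContinuousLinearMap.lsmul ℝ ℝ, volume] (T.indicator u)) x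
      = ∫ y, φ.normed volume (x - y) • G y := by
  set ψ : Euc n → ℝ := fun y => φ.normed volume (x - y) with hψ
  have hφd : ContDiff ℝ ∞ (φ.normed volume) := φ.contDiff_normed
  have hψd : ContDiff ℝ ∞ ψ := hφd.comp (contDiff_const.sub contDiff_id)
  have hts : tsupport ψ ⊆ Metric.closedBall (x - c) φ.rOut := by
    refine closure_minimal ?_ Metric.isClosed_closedBall
    intro y hy
    have : x - y ∈ Function.support (φ.normed volume) := hy
    rw [ContDiffBump.support_normed_eq, mem_ball_iff_norm] at this
    rw [mem_closedBall_iff_norm, ← norm_neg]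
    refine le_of_eq_of_le ?_ this.le
    congr 1; abel
  have hψc : HasCompactSupport ψ :=
    (isCompact_closedBall (x - c) φ.rOut).of_isClosed_subset (isClosed_tsupport ψ) hts
  have hψT := hts.trans hx
  have hψder : ∀ y a, fderiv ℝ ψ y a = - fderiv ℝ (φ.normed volume) (x - y) a := by
    intro y a
    have h1 : HasFDerivAt (fun y => x - y) (-ContinuousLinearMap.id ℝ (Euc n)) y :=
      (hasFDerivAt_id y).const_sub x
    have h2 := (hφd.differentiable (by simp) (x - y)).hasFDerivAt.comp y h1
    have h3 : fderiv ℝ ψ y = _ := h2.fderiv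
    rw [h3]
    simp
  refine ext_inner_right ℝ fun a => ?_
  rw [inner_gradient_eq_fderiv]
  have hder := φ.hasCompactSupport_normed.hasFDerivAt_convolution_left
    (ContinuousLinearMap.lsmul ℝ ℝ) (μ := volume) (hφd.of_le (by simp)) hi x
  rw [hder.fderiv]
  have hGi := hu.locallyIntegrableOn_gradient.integrable_smul_of_tsupport_subset
    hψd.continuous hψc hψT
  have hex : ConvolutionExistsAt (fderiv ℝ (φ.normed volume)) (T.indicator u) x
      ((ContinuousLinearMap.lsmul ℝ ℝ).precompL (Euc n)) volume :=
    (φ.hasCompactSupport_normed.fderiv ℝ).convolutionExists_left _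
      (hφd.continuous_fderiv (by simp)) hi x
  rw [convolution_def, ContinuousLinearMap.integral_apply hex,
    ← integral_sub_left_eq_self _ volume x]
  simp only [sub_sub_cancel, ContinuousLinearMap.precompL_apply]
  have e1 := hu.integral_eq ψ hψd hψc hψT a
  change _ = inner ℝ (∫ y, ψ y • G y) a
  rw [real_inner_comm, ← integral_inner hGi,
    ← setIntegral_eq_of_tsupport_subset (g := fun y => inner ℝ a (ψ y • G y)) hψT]
  · have e2 : ∫ y, ((ContinuousLinearMap.lsmul ℝ ℝ) (fderiv ℝ (φ.normed volume) (x - y) a))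
        (T.indicator u y) = - ∫ y in T, u y * fderiv ℝ ψ y a := by
      rw [← integral_indicator hT.measurableSet, ← integral_neg]
      refine integral_congr_ae (Eventually.of_forall fun y => ?_)
      by_cases hy : y ∈ T
      · simp only [hψder, indicator_of_mem hy, ContinuousLinearMap.lsmul_apply, smul_eq_mul]
        ring
      · simp [indicator_of_notMem hy]
    rw [e2, e1, neg_neg]
    refine integral_congr_ae (Eventually.of_forall fun y => ?_)
    simp only [real_inner_smul_right]
    rw [real_inner_comm, mul_comm]
  · intro y hy
    simp [image_eq_zero_of_notMem_tsupport hy]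

theorem sq_lintegral_le_lintegral_sq {Ω : Type*} [MeasurableSpace Ω] {ν : Measure Ω}
    [IsProbabilityMeasure ν] {F : Ω → ℝ≥0∞} (hF : AEMeasurable F ν) :
    (∫⁻ x, F x ∂ν) ^ 2 ≤ ∫⁻ x, F x ^ 2 ∂ν := by
  have h := ENNReal.lintegral_mul_le_Lp_mul_Lq ν (Real.HolderConjugate.two_two) hF
    (aemeasurable_const (b := (1 : ℝ≥0∞)))
  simp only [Pi.mul_apply, mul_one, ENNReal.one_rpow, lintegral_const, measure_univ] at h
  calc (∫⁻ x, F x ∂ν) ^ 2 ≤ ((∫⁻ x, F x ^ (2 : ℝ) ∂ν) ^ (1 / 2 : ℝ)) ^ 2 := by gcongr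
    _ = ∫⁻ x, F x ^ 2 ∂ν := by
      rw [← ENNReal.rpow_natCast, ← ENNReal.rpow_mul]
      norm_num

/-- Young's inequality for the convolution of an `L²` function with a probability measure. -/
theorem lintegral_sq_lintegral_sub_le {ν : Measure (Euc n)} [IsProbabilityMeasure ν]
    (hν : ν ≪ volume) {F : Euc n → ℝ≥0∞} (hF : AEMeasurable F) :
    ∫⁻ x, (∫⁻ t, F (x - t) ∂ν) ^ 2 ≤ ∫⁻ x, F x ^ 2 := by
  obtain ⟨F', hF', hFF'⟩ := hF
  have e1 : ∀ x, ∫⁻ t, F (x - t) ∂ν = ∫⁻ t, F' (x - t) ∂ν := by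
    intro x
    refine lintegral_congr_ae (hν.ae_le ?_)
    exact (quasiMeasurePreserving_sub_left volume x).ae hFF'
  have e2 : ∫⁻ x, F x ^ 2 = ∫⁻ x, F' x ^ 2 := by
    refine lintegral_congr_ae ?_
    filter_upwards [hFF'] with x hx
    rw [hx]
  simp only [e1, e2]
  calc ∫⁻ x, (∫⁻ t, F' (x - t) ∂ν) ^ 2 ≤ ∫⁻ x, ∫⁻ t, F' (x - t) ^ 2 ∂ν := by
        refine lintegral_mono fun x => sq_lintegral_le_lintegral_sq ?_
        exact (hF'.comp (measurable_const.sub measurable_id)).aemeasurable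
    _ = ∫⁻ t, ∫⁻ x, F' (x - t) ^ 2 ∂volume ∂ν := by
        refine lintegral_lintegral_swap (Measurable.aemeasurable ?_)
        exact (hF'.comp (by fun_prop)).pow_const 2
    _ = ∫⁻ x, F' x ^ 2 := by
        have : ∀ t : Euc n, ∫⁻ x, F' (x - t) ^ 2 = ∫⁻ x, F' x ^ 2 := fun t =>
          lintegral_sub_right_eq_self (fun x => F' x ^ 2) t
        simp only [this, lintegral_const, measure_univ, mul_one]

/-- The function `dist(·, ∂T)^(1/4)`: functions are weighted by its inverse and gradients by it, so
that squares carry the weights `dist(·, ∂T)^(-1/2)` and `dist(·, ∂T)^(1/2)`. -/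
noncomputable def bdryWeight (T : Set (Euc n)) (x : Euc n) : ℝ :=
  √√(Metric.infDist x (frontier T))

theorem continuous_bdryWeight : Continuous (bdryWeight T) :=
  Real.continuous_sqrt.comp (Real.continuous_sqrt.comp (Metric.continuous_infDist_pt _))

theorem bdryWeight_nonneg (x : Euc n) : 0 ≤ bdryWeight T x := Real.sqrt_nonneg _

theorem bdryWeight_pos (hT : IsOpen T) (hf : (frontier T).Nonempty) {x : Euc n} (hx : x ∈ T) :
    0 < bdryWeight T x :=
  Real.sqrt_pos.2 (Real.sqrt_pos.2 (infDist_frontier_pos hT hf hx))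

theorem bdryWeight_sq (x : Euc n) : bdryWeight T x ^ 2 = √(Metric.infDist x (frontier T)) :=
  Real.sq_sqrt (Real.sqrt_nonneg _)

variable {p e : Euc n} {r κ : ℝ}

theorem ConeCondition.exists_bdryWeight_le (hc : ConeCondition T p e r κ) (hT : IsOpen T)
    (hb : Bornology.IsBounded T) (hf : (frontier T).Nonempty) :
    ∃ C : ℝ≥0, ∀ x ∈ T, x ∈ Metric.ball p (r / 2) → ∀ h, 0 < h → h < r →
      ∀ z ∈ Metric.ball e κ, bdryWeight T x ≤ C * bdryWeight T (x + h • z) := by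
  obtain ⟨y₀, hy₀⟩ := hf
  obtain ⟨D, hD⟩ := hb.subset_closedBall y₀
  have hr := hc.2.1
  set C : ℝ := max 1 (2 * D / r) with hC
  have hC1 : 1 ≤ C := le_max_left _ _
  have hC2 : 2 * D / r ≤ C := le_max_right _ _
  refine ⟨⟨√√C, Real.sqrt_nonneg _⟩, ?_⟩
  intro x hx hxp h h0 hhr z hz
  have hmin := hc.min_le_infDist hT ⟨y₀, hy₀⟩ hx hxp h0 hhr hz
  have hdD : Metric.infDist x (frontier T) ≤ D :=
    (Metric.infDist_le_dist_of_mem hy₀).trans (hD hx)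
  have key : Metric.infDist x (frontier T) ≤ C * Metric.infDist (x + h • z) (frontier T) := by
    have h0 : 0 ≤ Metric.infDist x (frontier T) := Metric.infDist_nonneg
    have h1 : Metric.infDist x (frontier T) ≤ C * min (Metric.infDist x (frontier T)) (r / 2) := by
      rcases min_cases (Metric.infDist x (frontier T)) (r / 2) with ⟨h2, -⟩ | ⟨h2, -⟩ <;> rw [h2]
      · nlinarith
      · rw [div_le_iff₀ hr] at hC2
        linarith
    exact h1.trans (mul_le_mul_of_nonneg_left hmin (by linarith))
  change √√_ ≤ √√C * √√_
  rw [← Real.sqrt_mul (Real.sqrt_nonneg _), ← Real.sqrt_mul (by linarith)]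
  exact Real.sqrt_le_sqrt (Real.sqrt_le_sqrt key)

/-- Mollification with a kernel supported in the cone is bounded on gradients in the weighted `L²`
norm, uniformly in the scale `h`. -/
theorem ConeCondition.exists_lintegral_gradient_convolution_le (hc : ConeCondition T p e r κ)
    (hT : IsOpen T) (hb : Bornology.IsBounded T) (hf : (frontier T).Nonempty)
    (hu : HasWeakGradientOn T u G) (hi : LocallyIntegrable (T.indicator u)) :
    ∃ C : ℝ≥0, ∀ (h : ℝ) (φ : ContDiffBump (-(h • e))), 0 < h → h < r → φ.rOut < κ * h →
      ∫⁻ x in T ∩ Metric.ball p (r / 2), (‖∇ (φ.normed volume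
          ⋆[ContinuousLinearMap.lsmul ℝ ℝ, volume] (T.indicator u)) x‖ₑ
            * ENNReal.ofReal (bdryWeight T x)) ^ 2
        ≤ C * ∫⁻ x in T, (‖G x‖ₑ * ENNReal.ofReal (bdryWeight T x)) ^ 2 := by
  obtain ⟨C, hC⟩ := hc.exists_bdryWeight_le hT hb hf
  refine ⟨C ^ 2, fun h φ h0 hhr hφ => ?_⟩
  set m := bdryWeight T with hm
  have hmm : Measurable m := continuous_bdryWeight.measurable
  set F : Euc n → ℝ≥0∞ := T.indicator fun x => ‖G x‖ₑ * ENNReal.ofReal (m x) with hF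
  have hFm : AEMeasurable F := by
    rw [hF, aemeasurable_indicator_iff hT.measurableSet]
    exact hu.locallyIntegrableOn_gradient.aestronglyMeasurable.enorm.mul
      hmm.ennreal_ofReal.aemeasurable
  set ν : Measure (Euc n) := volume.withDensity fun t => ENNReal.ofReal (φ.normed volume t) with hν
  have hφm : Measurable fun t => ENNReal.ofReal (φ.normed volume t) :=
    φ.continuous_normed.measurable.ennreal_ofReal
  have hνp : IsProbabilityMeasure ν := by
    refine ⟨?_⟩
    rw [hν, withDensity_apply _ MeasurableSet.univ, Measure.restrict_univ,
      ← ofReal_integral_eq_lintegral_ofReal φ.integrable_normed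
        (Eventually.of_forall φ.nonneg_normed), φ.integral_normed, ENNReal.ofReal_one]
  have hpt : ∀ x ∈ T ∩ Metric.ball p (r / 2), ‖∇ (φ.normed volume
          ⋆[ContinuousLinearMap.lsmul ℝ ℝ, volume] (T.indicator u)) x‖ₑ
            * ENNReal.ofReal (m x) ≤ C * ∫⁻ t, F (x - t) ∂ν := by
    rintro x ⟨hxT, hxp⟩
    have hxr : x ∈ Metric.ball p r := Metric.ball_subset_ball (by linarith) hxp
    have hcone : ∀ t ∈ Metric.closedBall (-(h • e)) φ.rOut, -(h⁻¹ • t) ∈ Metric.ball e κ := by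
      intro t ht
      rw [mem_closedBall_iff_norm] at ht
      rw [mem_ball_iff_norm]
      have e1 : -(h⁻¹ • t) - e = -(h⁻¹ • (t - -(h • e))) := by
        rw [sub_neg_eq_add, smul_add, smul_smul, inv_mul_cancel₀ h0.ne', one_smul]; abel
      rw [e1, norm_neg, norm_smul, norm_inv, Real.norm_of_nonneg h0.le, inv_mul_lt_iff₀ h0]
      linarith
    have hcone' : ∀ t : Euc n, x - t = x + h • (-(h⁻¹ • t)) := by
      intro t
      rw [smul_neg, smul_smul, mul_inv_cancel₀ h0.ne', one_smul, sub_eq_add_neg]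
    have hsub : Metric.closedBall (x - -(h • e)) φ.rOut ⊆ T := by
      intro y hy
      have hy' : x - y ∈ Metric.closedBall (-(h • e)) φ.rOut := by
        rw [mem_closedBall_iff_norm] at hy ⊢
        rw [← norm_neg]
        refine le_of_eq_of_le ?_ hy
        congr 1; abel
      have := hc.2.2.2.2 x hxT hxr h h0 hhr _ (hcone _ hy')
      rwa [← hcone', sub_sub_cancel] at this
    rw [φ.gradient_convolution_indicator hu hT hi hsub]
    calc ‖∫ y, φ.normed volume (x - y) • G y‖ₑ * ENNReal.ofReal (m x)
        ≤ (∫⁻ y, ‖φ.normed volume (x - y) • G y‖ₑ) * ENNReal.ofReal (m x) := by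
          gcongr
          exact enorm_integral_le_lintegral_enorm _
      _ = (∫⁻ t, ‖φ.normed volume t • G (x - t)‖ₑ) * ENNReal.ofReal (m x) := by
          congr 1
          rw [← lintegral_sub_left_eq_self _ x]
          simp only [sub_sub_cancel]
      _ = ∫⁻ t, ‖φ.normed volume t • G (x - t)‖ₑ * ENNReal.ofReal (m x) :=
          (lintegral_mul_const' _ _ ENNReal.ofReal_ne_top).symm
      _ ≤ ∫⁻ t, ENNReal.ofReal (φ.normed volume t) * (C * F (x - t)) := by
          refine lintegral_mono fun t => ?_
          by_cases ht : t ∈ Metric.ball (-(h • e)) φ.rOut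
          swap
          · have : φ.normed volume t = 0 := by
              by_contra hne
              exact ht (φ.support_normed_eq (μ := volume) ▸ hne)
            simp [this]
          have hz := hcone t (Metric.ball_subset_closedBall ht)
          have hmem : x - t ∈ T := by
            rw [hcone']; exact hc.2.2.2.2 x hxT hxr h h0 hhr _ hz
          have hmle : m x ≤ C * m (x - t) := by
            rw [hcone' t]; exact hC x hxT hxp h h0 hhr _ hz
          rw [hF, indicator_of_mem hmem, enorm_smul, Real.enorm_eq_ofReal (φ.nonneg_normed t),
            mul_assoc]
          refine mul_le_mul' le_rfl ?_
          calc ‖G (x - t)‖ₑ * ENNReal.ofReal (m x)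
              ≤ ‖G (x - t)‖ₑ * ENNReal.ofReal (C * m (x - t)) := by gcongr
            _ = C * (‖G (x - t)‖ₑ * ENNReal.ofReal (m (x - t))) := by
              rw [ENNReal.ofReal_mul C.coe_nonneg, ENNReal.ofReal_coe_nnreal]; ring
      _ = ∫⁻ t, C * F (x - t) ∂ν := by
          rw [hν, lintegral_withDensity_eq_lintegral_mul_non_measurable₀ _ hφm.aemeasurable
            (Eventually.of_forall fun _ => ENNReal.ofReal_lt_top)]
          rfl
      _ = C * ∫⁻ t, F (x - t) ∂ν := lintegral_const_mul' _ _ ENNReal.coe_ne_top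
  calc ∫⁻ x in T ∩ Metric.ball p (r / 2), (‖∇ (φ.normed volume
          ⋆[ContinuousLinearMap.lsmul ℝ ℝ, volume] (T.indicator u)) x‖ₑ
            * ENNReal.ofReal (m x)) ^ 2
      ≤ ∫⁻ x in T ∩ Metric.ball p (r / 2), (C * ∫⁻ t, F (x - t) ∂ν) ^ 2 :=
        setLIntegral_mono' (hT.measurableSet.inter Metric.isOpen_ball.measurableSet) fun x hx =>
          pow_le_pow_left' (hpt x hx) 2
    _ ≤ ∫⁻ x, (C * ∫⁻ t, F (x - t) ∂ν) ^ 2 := setLIntegral_le_lintegral _ _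
    _ = C ^ 2 * ∫⁻ x, (∫⁻ t, F (x - t) ∂ν) ^ 2 := by
        simp only [mul_pow]
        rw [lintegral_const_mul' _ _ (by simp)]
    _ ≤ C ^ 2 * ∫⁻ x, F x ^ 2 := by
        refine mul_le_mul' le_rfl ?_
        exact lintegral_sq_lintegral_sub_le (withDensity_absolutelyContinuous _ _) hFm
    _ = _ := by
        rw [← lintegral_indicator hT.measurableSet]
        congr 1
        refine lintegral_congr fun x => ?_
        by_cases hx : x ∈ T <;> simp [hF, hx]

end Mollification

/-! ### Weak limits in the weighted Hilbert space -/

section WeakLimits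

/-- In a Hilbert space, a bounded sequence in a closed subspace that converges to `v` when tested
against a total set has its limit in the subspace. -/
theorem Submodule.mem_of_tendsto_inner {H : Type*} [NormedAddCommGroup H] [InnerProductSpace ℝ H]
    [CompleteSpace H] (S : Submodule ℝ H) (hS : IsClosed (S : Set H)) {D : Set H}
    (hD : ∀ z, (∀ y ∈ D, inner ℝ y z = 0) → z = 0) {u : ℕ → H} {v : H} (hu : ∀ k, u k ∈ S)
    {C : ℝ} (hC : ∀ k, ‖u k‖ ≤ C)
    (hlim : ∀ y ∈ D, Tendsto (fun k => inner ℝ y (u k)) atTop (𝓝 (inner ℝ y v))) : v ∈ S := by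
  have hall : ∀ y : H, Tendsto (fun k => inner ℝ y (u k)) atTop (𝓝 (inner ℝ y v)) := by
    have hspan : ∀ y ∈ Submodule.span ℝ D,
        Tendsto (fun k => inner ℝ y (u k)) atTop (𝓝 (inner ℝ y v)) := by
      intro y hy
      induction hy using Submodule.span_induction with
      | mem y hy => exact hlim y hy
      | zero => simp
      | add y z _ _ h1 h2 => simpa only [inner_add_left] using h1.add h2
      | smul a y _ h1 => simpa only [real_inner_smul_left] using h1.const_mul a
    have hdense : Dense (Submodule.span ℝ D : Set H) := by
      rw [Submodule.dense_iff_topologicalClosure_eq_top, Submodule.topologicalClosure_eq_top_iff,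
        Submodule.eq_bot_iff]
      intro z hz
      refine hD z fun y hy => ?_
      exact (Submodule.mem_orthogonal _ _).1 hz y (Submodule.subset_span hy)
    intro y
    rw [Metric.tendsto_atTop]
    intro ε hε
    have hC0 : 0 ≤ C := (norm_nonneg _).trans (hC 0)
    set M := C + ‖v‖ + 1 with hM
    have hM0 : 0 < M := by positivity
    obtain ⟨y', hy', hyy'⟩ := hdense.exists_dist_lt y (show 0 < ε / (2 * M) by positivity)
    obtain ⟨N, hN⟩ := Metric.tendsto_atTop.1 (hspan y' hy') (ε / 2) (by positivity)
    refine ⟨N, fun k hk => ?_⟩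
    have h1 := hN k hk
    rw [Real.dist_eq, ← inner_sub_right] at h1 ⊢
    have h2 : inner ℝ y (u k - v) = inner ℝ y' (u k - v) + inner ℝ (y - y') (u k - v) := by
      rw [inner_sub_left]; ring
    have h3 : |inner ℝ (y - y') (u k - v)| ≤ ε / (2 * M) * M := by
      refine (abs_real_inner_le_norm _ _).trans ?_
      rw [dist_eq_norm] at hyy'
      have : ‖u k - v‖ ≤ M := (norm_sub_le _ _).trans (by linarith [hC k])
      gcongr
    have h4 : ε / (2 * M) * M = ε / 2 := by field_simp
    rw [h2]
    refine (abs_add_le _ _).trans_lt ?_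
    linarith
  have hort : v ∈ Sᗮᗮ := by
    rw [Submodule.mem_orthogonal]
    intro y hy
    have h0 : ∀ k, inner ℝ y (u k) = 0 := fun k =>
      (Submodule.mem_orthogonal' _ _).1 hy _ (hu k)
    have := hall y
    simp only [h0] at this
    exact tendsto_nhds_unique this tendsto_const_nhds
  rwa [Submodule.orthogonal_orthogonal_eq_closure, hS.submodule_topologicalClosure_eq] at hort

variable {n : ℕ} {T : Set (Euc n)} {u : Euc n → ℝ} {G : Euc n → Euc n}

/-- The pair of a function `u` and a vector field `G`, weighted such that the square of the
pointwise norm is `|u|² dist(·, ∂T)^(-1/2) + |G|² dist(·, ∂T)^(1/2)`. -/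
noncomputable def weightedPair (T : Set (Euc n)) (u : Euc n → ℝ) (G : Euc n → Euc n) (x : Euc n) :
    WithLp 2 (ℝ × Euc n) :=
  WithLp.toLp 2 ((bdryWeight T x)⁻¹ * u x, bdryWeight T x • G x)

theorem norm_weightedPair_sq (x : Euc n) :
    ‖weightedPair T u G x‖ ^ 2
      = ((bdryWeight T x)⁻¹ * u x) ^ 2 + (bdryWeight T x * ‖G x‖) ^ 2 := by
  rw [weightedPair, WithLp.prod_norm_sq_eq_of_L2]
  simp [norm_smul, abs_of_nonneg (bdryWeight_nonneg x), mul_pow]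

theorem aestronglyMeasurable_weightedPair {μ : Measure (Euc n)} (hu : AEStronglyMeasurable u μ)
    (hG : AEStronglyMeasurable G μ) : AEStronglyMeasurable (weightedPair T u G) μ := by
  have hm : AEStronglyMeasurable (bdryWeight T) μ := continuous_bdryWeight.aestronglyMeasurable
  have hmi : AEStronglyMeasurable (fun x => (bdryWeight T x)⁻¹) μ :=
    continuous_bdryWeight.measurable.inv.aestronglyMeasurable
  exact (WithLp.prod_continuous_toLp 2 ℝ (Euc n)).comp_aestronglyMeasurable
    ((hmi.mul hu).prodMk (hm.smul hG))

theorem HasWeakGradientOn.aestronglyMeasurable_weightedPair (h : HasWeakGradientOn T u G) :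
    AEStronglyMeasurable (weightedPair T u G) (volume.restrict T) :=
  _root_.aestronglyMeasurable_weightedPair h.locallyIntegrableOn.aestronglyMeasurable
    h.locallyIntegrableOn_gradient.aestronglyMeasurable

/-- The Hilbert space of square integrable pairs. -/
abbrev PairSpace (T : Set (Euc n)) : Type := Lp (WithLp 2 (ℝ × Euc n)) 2 (volume.restrict T)

/-- The weighted pair of `u` and `G` is square integrable and represents an element of `S`. -/
def PairMem (S : Submodule ℝ (PairSpace T)) (u : Euc n → ℝ) (G : Euc n → Euc n) : Prop :=
  ∃ h : MemLp (weightedPair T u G) 2 (volume.restrict T), h.toLp (weightedPair T u G) ∈ S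

theorem continuous_mul_inv_bdryWeight (hT : IsOpen T) (hf : (frontier T).Nonempty)
    {φ : Euc n → ℝ} (hφ : Continuous φ) (hs : tsupport φ ⊆ T) :
    Continuous fun x => φ x * (bdryWeight T x)⁻¹ := by
  refine continuous_of_tsupport fun x hx => ?_
  have hxT : x ∈ T := hs (tsupport_mul_subset_left hx)
  exact hφ.continuousAt.mul
    (continuous_bdryWeight.continuousAt.inv₀ (bdryWeight_pos hT hf hxT).ne')

theorem memLp_testPair_fst {φ : Euc n → ℝ} (hφ : Continuous φ) (hc : HasCompactSupport φ) :
    MemLp (fun x => WithLp.toLp 2 (bdryWeight T x * φ x, (0 : Euc n))) 2 (volume.restrict T) := by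
  refine Continuous.memLp_of_hasCompactSupport ?_ ?_
  · exact (WithLp.prod_continuous_toLp 2 ℝ (Euc n)).comp
      ((continuous_bdryWeight.mul hφ).prodMk continuous_const)
  · refine hc.mono fun x hx h0 => hx ?_
    simp [h0]

theorem memLp_testPair_snd (hT : IsOpen T) (hf : (frontier T).Nonempty) {φ : Euc n → ℝ}
    (hφ : Continuous φ) (hc : HasCompactSupport φ) (hs : tsupport φ ⊆ T) (a : Euc n) :
    MemLp (fun x => WithLp.toLp 2 ((0 : ℝ), (φ x * (bdryWeight T x)⁻¹) • a)) 2
      (volume.restrict T) := by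
  refine Continuous.memLp_of_hasCompactSupport ?_ ?_
  · exact (WithLp.prod_continuous_toLp 2 ℝ (Euc n)).comp
      (continuous_const.prodMk ((continuous_mul_inv_bdryWeight hT hf hφ hs).smul continuous_const))
  · refine hc.mono fun x hx h0 => hx ?_
    simp [h0]

/-- The elements of the pair space that are given, up to the weights, by test functions. -/
def testPairs (T : Set (Euc n)) : Set (PairSpace T) :=
  {y | ∃ φ : Euc n → ℝ, ContDiff ℝ ∞ φ ∧ HasCompactSupport φ ∧ tsupport φ ⊆ T ∧
    (y =ᵐ[volume.restrict T] (fun x => WithLp.toLp 2 (bdryWeight T x * φ x, (0 : Euc n))) ∨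
      ∃ a : Euc n, y =ᵐ[volume.restrict T]
        fun x => WithLp.toLp 2 ((0 : ℝ), (φ x * (bdryWeight T x)⁻¹) • a))}

theorem eq_zero_of_forall_testPairs (hT : IsOpen T) (hf : (frontier T).Nonempty) (z : PairSpace T)
    (hz : ∀ y ∈ testPairs T, inner ℝ y z = 0) : z = 0 := by
  have hzm := Lp.memLp z
  have hz1 : MemLp (fun x => (z x).fst) 2 (volume.restrict T) :=
    hzm.mono ((WithLp.continuous_fst 2 ℝ (Euc n)).comp_aestronglyMeasurable hzm.1)
      (Eventually.of_forall fun x => WithLp.norm_fst_le _ _)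
  have hz2 : MemLp (fun x => (z x).snd) 2 (volume.restrict T) :=
    hzm.mono ((WithLp.continuous_snd 2 ℝ (Euc n)).comp_aestronglyMeasurable hzm.1)
      (Eventually.of_forall fun x => WithLp.norm_snd_le _ _)
  have hl1 : LocallyIntegrableOn (fun x => (z x).fst) T :=
    locallyIntegrableOn_of_locallyIntegrable_restrict (hz1.locallyIntegrable (by norm_num))
  have hl2 : LocallyIntegrableOn (fun x => (z x).snd) T :=
    locallyIntegrableOn_of_locallyIntegrable_restrict (hz2.locallyIntegrable (by norm_num))
  have hmi : ContinuousOn (fun x => (bdryWeight T x)⁻¹) T :=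
    continuous_bdryWeight.continuousOn.inv₀ fun x hx => (bdryWeight_pos hT hf hx).ne'
  have h1 : ∀ᵐ x, x ∈ T → bdryWeight T x * (z x).fst = 0 := by
    refine hT.ae_eq_zero_of_integral_contDiff_smul_eq_zero
      (hl1.continuousOn_mul continuous_bdryWeight.continuousOn hT.isLocallyClosed) ?_
    intro φ hφ hc hs
    have hΦ := memLp_testPair_fst (T := T) hφ.continuous hc
    have h := hz (hΦ.toLp _) ⟨φ, hφ, hc, hs, Or.inl hΦ.coeFn_toLp⟩
    rw [L2.inner_def] at h
    rw [← setIntegral_eq_of_tsupport_subset hs, ← h]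
    · refine integral_congr_ae ?_
      filter_upwards [hΦ.coeFn_toLp] with x hx
      rw [hx, WithLp.prod_inner_apply]
      simp only [smul_eq_mul, inner_zero_left, add_zero]
      simp
      ring
    · intro x hx
      simp [image_eq_zero_of_notMem_tsupport hx]
  have h2 : ∀ᵐ x, x ∈ T → (bdryWeight T x)⁻¹ • (z x).snd = 0 := by
    have hloc : LocallyIntegrableOn (fun x => (bdryWeight T x)⁻¹ • (z x).snd) T :=
      hl2.continuousOn_smul hT.isLocallyClosed hmi
    refine hT.ae_eq_zero_of_integral_contDiff_smul_eq_zero hloc ?_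
    intro φ hφ hc hs
    have hint := hloc.integrable_smul_of_tsupport_subset hφ.continuous hc hs
    refine ext_inner_left ℝ fun a => ?_
    have hΦ := memLp_testPair_snd hT hf hφ.continuous hc hs a
    have h := hz (hΦ.toLp _) ⟨φ, hφ, hc, hs, Or.inr ⟨a, hΦ.coeFn_toLp⟩⟩
    rw [L2.inner_def] at h
    rw [inner_zero_right, ← integral_inner hint, ← h,
      ← setIntegral_eq_of_tsupport_subset
        (g := fun x => inner ℝ a (φ x • (bdryWeight T x)⁻¹ • (z x).snd)) hs]
    · refine integral_congr_ae ?_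
      filter_upwards [hΦ.coeFn_toLp] with x hx
      rw [hx, WithLp.prod_inner_apply]
      simp only [real_inner_smul_left, real_inner_smul_right, inner_zero_left, zero_add]
      exact (mul_assoc _ _ _).symm
    · intro x hx
      simp [image_eq_zero_of_notMem_tsupport hx]
  rw [Lp.eq_zero_iff_ae_eq_zero]
  rw [EventuallyEq, ae_restrict_iff' hT.measurableSet]
  filter_upwards [h1, h2] with x hx1 hx2 hxT
  have hm := (bdryWeight_pos hT hf hxT).ne'
  have e1 : (z x).fst = 0 := by simpa [hm] using hx1 hxT
  have e2 : (z x).snd = 0 := by simpa [hm] using hx2 hxT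
  exact WithLp.ofLp_injective 2 (Prod.ext e1 e2)

theorem inner_testPair_fst (hT : IsOpen T) (hf : (frontier T).Nonempty) {φ : Euc n → ℝ}
    {y : PairSpace T}
    (hy : y =ᵐ[volume.restrict T] fun x => WithLp.toLp 2 (bdryWeight T x * φ x, (0 : Euc n)))
    (h : MemLp (weightedPair T u G) 2 (volume.restrict T)) :
    inner ℝ y (h.toLp _) = ∫ x in T, u x * φ x := by
  rw [L2.inner_def]
  refine integral_congr_ae ?_
  filter_upwards [hy, h.coeFn_toLp, ae_restrict_mem hT.measurableSet] with x hx1 hx2 hxT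
  have hm := (bdryWeight_pos hT hf hxT).ne'
  rw [hx1, hx2, WithLp.prod_inner_apply, weightedPair]
  simp only [inner_zero_left, add_zero]
  simp
  field_simp

theorem inner_testPair_snd (hT : IsOpen T) (hf : (frontier T).Nonempty) {φ : Euc n → ℝ}
    (hu : HasWeakGradientOn T u G) (hφ : ContDiff ℝ ∞ φ) (hc : HasCompactSupport φ)
    (hs : tsupport φ ⊆ T) {a : Euc n} {y : PairSpace T}
    (hy : y =ᵐ[volume.restrict T]
      fun x => WithLp.toLp 2 ((0 : ℝ), (φ x * (bdryWeight T x)⁻¹) • a))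
    (h : MemLp (weightedPair T u G) 2 (volume.restrict T)) :
    inner ℝ y (h.toLp _) = -∫ x in T, u x * fderiv ℝ φ x a := by
  rw [L2.inner_def, hu.integral_eq φ hφ hc hs a, neg_neg]
  refine integral_congr_ae ?_
  filter_upwards [hy, h.coeFn_toLp, ae_restrict_mem hT.measurableSet] with x hx1 hx2 hxT
  have hm := (bdryWeight_pos hT hf hxT).ne'
  rw [hx1, hx2, WithLp.prod_inner_apply, weightedPair]
  simp only [inner_zero_left, zero_add, real_inner_smul_left, real_inner_smul_right]
  rw [real_inner_comm]
  field_simp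

/-- A closed subspace of pairs contains the limit `(v, G)` of a sequence of pairs of functions and
weak gradients which is bounded in the weighted norm, as soon as the functions converge in the sense
of distributions: no convergence of gradients has to be verified. -/
theorem PairMem.of_tendsto (hT : IsOpen T) (hf : (frontier T).Nonempty)
    {S : Submodule ℝ (PairSpace T)} (hS : IsClosed (S : Set (PairSpace T)))
    {w : ℕ → Euc n → ℝ} {W : ℕ → Euc n → Euc n} (hw : ∀ k, HasWeakGradientOn T (w k) (W k))
    (hmem : ∀ k, PairMem S (w k) (W k)) {C : ℝ≥0}
    (hC : ∀ k, eLpNorm (weightedPair T (w k) (W k)) 2 (volume.restrict T) ≤ C)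
    (hu : HasWeakGradientOn T u G) (h : MemLp (weightedPair T u G) 2 (volume.restrict T))
    (hlim : ∀ φ : Euc n → ℝ, ContDiff ℝ ∞ φ → HasCompactSupport φ → tsupport φ ⊆ T →
      Tendsto (fun k => ∫ x in T, w k x * φ x) atTop (𝓝 (∫ x in T, u x * φ x))) :
    PairMem S u G := by
  choose hm hmS using hmem
  refine ⟨h, Submodule.mem_of_tendsto_inner S hS (eq_zero_of_forall_testPairs hT hf) hmS
    (C := C) (fun k => ?_) ?_⟩
  · rw [Lp.norm_toLp]
    exact ENNReal.toReal_le_of_le_ofReal C.coe_nonneg (by simpa using hC k)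
  · rintro y ⟨φ, hφ, hc, hs, hy | ⟨a, hy⟩⟩
    · simp only [inner_testPair_fst hT hf hy]
      exact hlim φ hφ hc hs
    · simp only [inner_testPair_snd hT hf (hw _) hφ hc hs hy,
        inner_testPair_snd hT hf hu hφ hc hs hy]
      refine (hlim (fun x => fderiv ℝ φ x a) ?_ (hc.fderiv_apply ℝ a)
        ((tsupport_fderiv_apply_subset ℝ a).trans hs)).neg
      exact (hφ.fderiv_right (m := ∞) (by simp)).clm_apply contDiff_const

end WeakLimits

/-! ### Smooth truncation -/

section Truncation

/-- A smooth truncation of the real line at height of order `M`. -/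
noncomputable def smoothTrunc (M s : ℝ) : ℝ := M * Real.arctan (s / M)

variable {M : ℝ}

theorem contDiff_smoothTrunc : ContDiff ℝ ∞ (smoothTrunc M) :=
  contDiff_const.mul (Real.contDiff_arctan.comp (contDiff_id.div_const M))

theorem hasDerivAt_smoothTrunc (hM : 0 < M) (s : ℝ) :
    HasDerivAt (smoothTrunc M) (1 / (1 + (s / M) ^ 2)) s := by
  have h := (((hasDerivAt_id s).div_const M).arctan).const_mul M
  refine h.congr_deriv ?_
  simp only [id]
  field_simp

theorem abs_smoothTrunc_le (hM : 0 < M) (s : ℝ) : |smoothTrunc M s| ≤ |s| := by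
  have h : ∀ x : ℝ, ‖deriv (smoothTrunc M) x‖ ≤ 1 := by
    intro x
    rw [(hasDerivAt_smoothTrunc hM x).deriv, Real.norm_of_nonneg (by positivity),
      div_le_one (by positivity)]
    nlinarith [sq_nonneg (x / M)]
  have := Convex.norm_image_sub_le_of_norm_deriv_le (f := smoothTrunc M) (s := univ) (x := 0)
    (y := s) (fun x _ => (hasDerivAt_smoothTrunc hM x).differentiableAt) (fun x _ => h x)
    convex_univ (mem_univ _) (mem_univ _)
  simpa [smoothTrunc] using this

theorem abs_smoothTrunc_le_two_mul (hM : 0 < M) (s : ℝ) : |smoothTrunc M s| ≤ 2 * M := by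
  rw [smoothTrunc, abs_mul, abs_of_pos hM, mul_comm]
  gcongr
  rw [abs_le]
  have h1 := Real.arctan_lt_pi_div_two (s / M)
  have h2 := Real.neg_pi_div_two_lt_arctan (s / M)
  have h3 := Real.pi_le_four
  constructor <;> linarith

theorem tendsto_smoothTrunc (s : ℝ) :
    Tendsto (fun k : ℕ => smoothTrunc (k + 1) s) atTop (𝓝 s) := by
  have h1 : HasDerivAt (fun t : ℝ => Real.arctan (t * s)) s 0 := by
    have := ((hasDerivAt_id (0 : ℝ)).mul_const s).arctan
    simpa using this
  have h2 := (hasDerivAt_iff_tendsto_slope_zero.1 h1)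
  have h3 : Tendsto (fun k : ℕ => 1 / ((k : ℝ) + 1)) atTop (𝓝[≠] 0) :=
    tendsto_nhdsWithin_iff.2 ⟨tendsto_one_div_add_atTop_nhds_zero_nat,
      Eventually.of_forall fun k => by
        have : (0 : ℝ) < 1 / ((k : ℝ) + 1) := by positivity
        exact this.ne'⟩
  refine (h2.comp h3).congr fun k => ?_
  simp only [Function.comp_apply, smul_eq_mul, zero_add, zero_mul, Real.arctan_zero, sub_zero,
    smoothTrunc]
  rw [one_div, inv_inv, div_eq_inv_mul]

end Truncation

/-! ### Density of smooth functions in the weighted space on the parameter domain -/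

section Density

variable {n : ℕ} {T : Set (Euc n)} {v : Euc n → ℝ} {G : Euc n → Euc n}
  {S : Submodule ℝ (PairSpace T)}

theorem PairMem.congr {u u' : Euc n → ℝ} {G' : Euc n → Euc n} (h : PairMem S u G)
    (hT : MeasurableSet T) (hu : EqOn u' u T) (hG : EqOn G' G T) : PairMem S u' G' := by
  obtain ⟨hm, hS⟩ := h
  have hae : weightedPair T u G =ᵐ[volume.restrict T] weightedPair T u' G' := by
    filter_upwards [ae_restrict_mem hT] with x hx
    rw [weightedPair, weightedPair, hu hx, hG hx]
  have hm' := (memLp_congr_ae hae).1 hm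
  refine ⟨hm', ?_⟩
  rwa [← (MemLp.toLp_eq_toLp_iff hm hm').2 hae]

theorem PairMem.add {u u' : Euc n → ℝ} {G' : Euc n → Euc n} (h : PairMem S u G)
    (h' : PairMem S u' G') : PairMem S (fun x => u x + u' x) (fun x => G x + G' x) := by
  obtain ⟨hm, hS⟩ := h
  obtain ⟨hm', hS'⟩ := h'
  have e : weightedPair T (fun x => u x + u' x) (fun x => G x + G' x)
      = weightedPair T u G + weightedPair T u' G' := by
    funext x
    simp only [weightedPair, Pi.add_apply, ← WithLp.toLp_add, Prod.mk_add_mk, mul_add, smul_add]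
  rw [PairMem, e]
  exact ⟨hm.add hm', by rw [MemLp.toLp_add hm hm']; exact S.add_mem hS hS'⟩

theorem PairMem.neg {u : Euc n → ℝ} (h : PairMem S u G) :
    PairMem S (fun x => -u x) (fun x => -G x) := by
  obtain ⟨hm, hS⟩ := h
  have e : weightedPair T (fun x => -u x) (fun x => -G x) = -weightedPair T u G := by
    funext x
    simp only [weightedPair, Pi.neg_apply, ← WithLp.toLp_neg, Prod.neg_mk, mul_neg, smul_neg]
  rw [PairMem, e]
  exact ⟨hm.neg, by rw [MemLp.toLp_neg hm]; exact S.neg_mem hS⟩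

theorem exists_bdryWeight_le_of_isBounded (hb : Bornology.IsBounded T)
    (hf : (frontier T).Nonempty) : ∃ B : ℝ, 0 < B ∧ ∀ x ∈ T, bdryWeight T x ≤ B := by
  obtain ⟨y₀, hy₀⟩ := hf
  obtain ⟨D, hD⟩ := hb.subset_closedBall y₀
  refine ⟨√√D + 1, by positivity, fun x hx => ?_⟩
  have : Metric.infDist x (frontier T) ≤ D := (Metric.infDist_le_dist_of_mem hy₀).trans (hD hx)
  have h2 : bdryWeight T x ≤ √√D := Real.sqrt_le_sqrt (Real.sqrt_le_sqrt this)
  linarith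

theorem abs_inv_bdryWeight_mul_le (u : Euc n → ℝ) (x : Euc n) :
    |(bdryWeight T x)⁻¹ * u x| ≤ ‖weightedPair T u G x‖ := by
  have h := norm_weightedPair_sq (T := T) (u := u) (G := G) x
  refine abs_le_of_sq_le_sq ?_ (norm_nonneg _)
  nlinarith [sq_nonneg (bdryWeight T x * ‖G x‖)]

theorem bdryWeight_mul_norm_le (u : Euc n → ℝ) (x : Euc n) :
    bdryWeight T x * ‖G x‖ ≤ ‖weightedPair T u G x‖ := by
  have h := norm_weightedPair_sq (T := T) (u := u) (G := G) x
  refine le_of_abs_le (abs_le_of_sq_le_sq ?_ (norm_nonneg _))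
  nlinarith [sq_nonneg ((bdryWeight T x)⁻¹ * u x)]

theorem norm_weightedPair_le (u : Euc n → ℝ) (x : Euc n) :
    ‖weightedPair T u G x‖ ≤ |(bdryWeight T x)⁻¹ * u x| + bdryWeight T x * ‖G x‖ := by
  have h := norm_weightedPair_sq (T := T) (u := u) (G := G) x
  have h0 : 0 ≤ bdryWeight T x * ‖G x‖ := mul_nonneg (bdryWeight_nonneg x) (norm_nonneg _)
  refine le_of_abs_le (abs_le_of_sq_le_sq ?_ (by positivity))
  nlinarith [sq_abs ((bdryWeight T x)⁻¹ * u x), abs_nonneg ((bdryWeight T x)⁻¹ * u x)]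

theorem integrableOn_of_memLp_weightedPair (hT : IsOpen T) (hb : Bornology.IsBounded T)
    (hf : (frontier T).Nonempty) (hv : AEStronglyMeasurable v (volume.restrict T))
    (h : MemLp (weightedPair T v G) 2 (volume.restrict T)) : IntegrableOn v T := by
  obtain ⟨B, hB0, hB⟩ := exists_bdryWeight_le_of_isBounded hb hf
  have : IsFiniteMeasure (volume.restrict T) := ⟨by simpa using hb.measure_lt_top⟩
  refine ((h.integrable (by norm_num)).norm.const_mul B).mono' hv ?_
  filter_upwards [ae_restrict_mem hT.measurableSet] with x hx
  have hm := bdryWeight_pos hT hf hx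
  have e : v x = bdryWeight T x * ((bdryWeight T x)⁻¹ * v x) := by
    rw [← mul_assoc, mul_inv_cancel₀ hm.ne', one_mul]
  rw [Real.norm_eq_abs, e, abs_mul, abs_of_pos hm]
  exact mul_le_mul (hB x hx) (abs_inv_bdryWeight_mul_le v x) (abs_nonneg _) hB0.le

theorem eLpNorm_two_sq {F : Type*} [NormedAddCommGroup F] {μ : Measure (Euc n)} {g : Euc n → F} :
    eLpNorm g 2 μ ^ 2 = ∫⁻ x, ‖g x‖ₑ ^ 2 ∂μ := by
  have := eLpNorm_nnreal_pow_eq_lintegral (μ := μ) (f := g) (p := 2) (by norm_num)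
  simpa using this

theorem eLpNorm_two_le_of_lintegral_sq_le {F : Type*} [NormedAddCommGroup F]
    {μ : Measure (Euc n)} {g : Euc n → F} {C : ℝ≥0∞} (h : ∫⁻ x, ‖g x‖ₑ ^ 2 ∂μ ≤ C ^ 2) :
    eLpNorm g 2 μ ≤ C := by
  rw [← eLpNorm_two_sq] at h
  exact (ENNReal.pow_le_pow_left_iff two_ne_zero).1 h

end Density

section Density

variable {n : ℕ} {T : Set (Euc n)} {v : Euc n → ℝ} {G : Euc n → Euc n}
  {S : Submodule ℝ (PairSpace T)} {p e : Euc n} {r κ : ℝ}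

/-- The mollifier at scale `h`, supported well inside the reflected cone `-(0, h] • ball e κ`. -/
noncomputable def coneBump (e : Euc n) {κ h : ℝ} (hκ : 0 < κ) (hh : 0 < h) :
    ContDiffBump (-(h • e)) where
  rIn := κ * h / 4
  rOut := κ * h / 2
  rIn_pos := by positivity
  rIn_lt_rOut := by
    have : 0 < κ * h := by positivity
    linarith

theorem lintegral_inv_bdryWeight_sq_lt_top (hT : IsLipschitzDomain T)
    (hb : Bornology.IsBounded T) (hf : (frontier T).Nonempty) :
    ∫⁻ x in T, ‖(bdryWeight T x)⁻¹‖ₑ ^ 2 < ⊤ := by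
  have h := (hT.integrableOn_inv_sqrt_infDist hb hf).2
  refine lt_of_eq_of_lt (lintegral_congr fun x => ?_) h
  rw [← enorm_pow, inv_pow, bdryWeight_sq]

/-- For every truncation height `k + 1`, some member of a sequence of continuous functions
converging almost everywhere to `v` has a truncation with weighted norm bounded
independently of `k`, close in `L¹` to the truncation of `v`. At a fixed height the weighted `L²`
norms converge by dominated convergence, as `dist(·, ∂T)^(-1/2)` is integrable. -/
theorem exists_truncated_mollification_seq (hT : IsLipschitzDomain T) (hb : Bornology.IsBounded T)
    (hf : (frontier T).Nonempty) (hv : AEStronglyMeasurable v (volume.restrict T))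
    {g : ℕ → Euc n → ℝ} (hg : ∀ j, Continuous (g j))
    (hlim : ∀ᵐ x ∂(volume.restrict T), Tendsto (fun j => g j x) atTop (𝓝 (v x)))
    (hfin : ∫⁻ x in T, ‖(bdryWeight T x)⁻¹ * v x‖ₑ ^ 2 < ⊤) (k : ℕ) :
    ∃ j, ∫⁻ x in T, ‖(bdryWeight T x)⁻¹ * smoothTrunc (k + 1) (g j x)‖ₑ ^ 2
        ≤ (∫⁻ x in T, ‖(bdryWeight T x)⁻¹ * v x‖ₑ ^ 2) + 1 ∧
      ∫ x in T, |smoothTrunc (k + 1) (g j x) - smoothTrunc (k + 1) (v x)| ≤ 1 / ((k : ℝ) + 1) := by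
  have : IsFiniteMeasure (volume.restrict T) := ⟨by simpa using hb.measure_lt_top⟩
  have hk : (0 : ℝ) < k + 1 := by positivity
  have hmm : Measurable fun x => (bdryWeight T x)⁻¹ := continuous_bdryWeight.measurable.inv
  have hct : Continuous (smoothTrunc ((k : ℝ) + 1)) := contDiff_smoothTrunc.continuous
  have hlim' : ∀ᵐ x ∂(volume.restrict T), Tendsto (fun j => smoothTrunc (k + 1) (g j x)) atTop
      (𝓝 (smoothTrunc (k + 1) (v x))) := by
    filter_upwards [hlim] with x hx using (hct.tendsto _).comp hx
  have h1 : Tendsto (fun j => ∫⁻ x in T, ‖(bdryWeight T x)⁻¹ * smoothTrunc (k + 1) (g j x)‖ₑ ^ 2)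
      atTop (𝓝 (∫⁻ x in T, ‖(bdryWeight T x)⁻¹ * smoothTrunc (k + 1) (v x)‖ₑ ^ 2)) := by
    refine tendsto_lintegral_of_dominated_convergence
      (fun x => ‖(bdryWeight T x)⁻¹‖ₑ ^ 2 * ENNReal.ofReal (2 * (k + 1)) ^ 2) ?_ ?_ ?_ ?_
    · intro j
      exact ((hmm.mul (hct.comp (hg j)).measurable).enorm).pow_const 2
    · intro j
      refine Eventually.of_forall fun x => ?_
      simp only [enorm_mul, mul_pow]
      refine mul_le_mul' le_rfl (pow_le_pow_left' ?_ 2)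
      rw [Real.enorm_eq_ofReal_abs]
      exact ENNReal.ofReal_le_ofReal (abs_smoothTrunc_le_two_mul hk _)
    · have hne : ENNReal.ofReal (2 * (k + 1)) ^ 2 ≠ ⊤ := ENNReal.pow_ne_top ENNReal.ofReal_ne_top
      rw [lintegral_mul_const' _ _ hne]
      exact ENNReal.mul_ne_top (lintegral_inv_bdryWeight_sq_lt_top hT hb hf).ne hne
    · filter_upwards [hlim'] with x hx
      exact ((ENNReal.continuous_pow 2).tendsto _).comp
        ((continuous_enorm.tendsto _).comp (hx.const_mul _))
  have h1' : ∫⁻ x in T, ‖(bdryWeight T x)⁻¹ * smoothTrunc (k + 1) (v x)‖ₑ ^ 2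
      < (∫⁻ x in T, ‖(bdryWeight T x)⁻¹ * v x‖ₑ ^ 2) + 1 := by
    refine lt_of_le_of_lt (lintegral_mono fun x => ?_) (ENNReal.lt_add_right hfin.ne one_ne_zero)
    refine pow_le_pow_left' ?_ 2
    rw [enorm_mul, enorm_mul]
    refine mul_le_mul' le_rfl ?_
    rw [Real.enorm_eq_ofReal_abs, Real.enorm_eq_ofReal_abs]
    exact ENNReal.ofReal_le_ofReal (abs_smoothTrunc_le hk _)
  have h2 : Tendsto (fun j => ∫ x in T, |smoothTrunc (k + 1) (g j x) - smoothTrunc (k + 1) (v x)|)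
      atTop (𝓝 (∫ x in T, (0 : ℝ))) := by
    refine tendsto_integral_of_dominated_convergence (fun _ => 2 * (k + 1) + 2 * (k + 1)) ?_
      (integrable_const _) ?_ ?_
    · intro j
      exact (((hct.comp (hg j)).aestronglyMeasurable).sub
        (hct.comp_aestronglyMeasurable hv)).norm
    · intro j
      refine Eventually.of_forall fun x => ?_
      rw [Real.norm_eq_abs, abs_abs]
      exact (abs_sub _ _).trans (add_le_add (abs_smoothTrunc_le_two_mul hk _)
        (abs_smoothTrunc_le_two_mul hk _))
    · filter_upwards [hlim'] with x hx
      have := (hx.sub_const (smoothTrunc (k + 1) (v x))).abs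
      simpa using this
  rw [integral_zero] at h2
  have hpos : 0 < 1 / ((k : ℝ) + 1) := by positivity
  obtain ⟨j, hj1, hj2⟩ := ((h1.eventually_lt_const h1').and (h2.eventually_lt_const hpos)).exists
  exact ⟨j, hj1.le, hj2.le⟩

theorem norm_gradient_mul_comp_le {θ g : Euc n → ℝ} {ψ : ℝ → ℝ} {c : ℝ} {x : Euc n}
    (hθ : DifferentiableAt ℝ θ x) (hg : DifferentiableAt ℝ g x) (hψ : HasDerivAt ψ c (g x))
    (hc : |c| ≤ 1) :
    ‖∇ (fun y => θ y * ψ (g y)) x‖ ≤ |θ x| * ‖∇ g x‖ + |ψ (g x)| * ‖∇ θ x‖ := by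
  simp only [norm_gradient_eq]
  have h1 : HasFDerivAt (fun y => ψ (g y)) (c • fderiv ℝ g x) x :=
    hψ.comp_hasFDerivAt x hg.hasFDerivAt
  have h2 : fderiv ℝ (fun y => θ y * ψ (g y)) x = _ := (hθ.hasFDerivAt.mul h1).fderiv
  rw [h2]
  refine (norm_add_le _ _).trans ?_
  rw [norm_smul, norm_smul, norm_smul, Real.norm_eq_abs, Real.norm_eq_abs, Real.norm_eq_abs]
  gcongr
  exact mul_le_of_le_one_left (norm_nonneg _) hc

/-- A function in the weighted space that is cut off to a neighbourhood of a point with the cone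
condition lies in every closed subspace that contains all test functions. -/
theorem PairMem.smooth_mul_of_coneCondition (hT : IsLipschitzDomain T) (hb : Bornology.IsBounded T)
    (hf : (frontier T).Nonempty) (hS : IsClosed (S : Set (PairSpace T)))
    (hsm : ∀ w : Euc n → ℝ, ContDiff ℝ ∞ w → HasCompactSupport w → PairMem S w (∇ w))
    (hv : HasWeakGradientOn T v G) (hm : MemLp (weightedPair T v G) 2 (volume.restrict T))
    (hc : ConeCondition T p e r κ) {θ : Euc n → ℝ} (hθ : ContDiff ℝ ∞ θ)
    (hθc : HasCompactSupport θ) (hθs : tsupport θ ⊆ Metric.ball p (r / 2)) :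
    PairMem S (fun x => θ x * v x) (fun x => θ x • G x + v x • ∇ θ x) := by
  have hTm := hT.isOpen.measurableSet
  have hvm := hv.locallyIntegrableOn.aestronglyMeasurable
  have hvi := integrableOn_of_memLp_weightedPair hT.isOpen hb hf hvm hm
  have hind : LocallyIntegrable (T.indicator v) :=
    ((integrable_indicator_iff hTm).2 hvi).locallyIntegrable
  have hr := hc.2.1
  have hκ := hc.2.2.1
  obtain ⟨B, hB0, hB⟩ := exists_bdryWeight_le_of_isBounded hb hf
  obtain ⟨C, hC⟩ := hc.exists_lintegral_gradient_convolution_le hT.isOpen hb hf hv hind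
  -- the scales `r / (j + 2)` of the mollifiers
  have hh0 : ∀ j : ℕ, 0 < r / (j + 2) := fun j => by positivity
  have hhr : ∀ j : ℕ, r / (j + 2) < r := fun j => by
    rw [div_lt_iff₀ (by positivity)]
    nlinarith [(Nat.cast_nonneg j : (0 : ℝ) ≤ j)]
  set φ : ∀ j : ℕ, ContDiffBump (-((r / ((j : ℝ) + 2)) • e)) := fun j => coneBump e hκ (hh0 j)
    with hφ
  set g : ℕ → Euc n → ℝ := fun j =>
    (φ j).normed volume ⋆[ContinuousLinearMap.lsmul ℝ ℝ, volume] (T.indicator v) with hg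
  have hgd : ∀ j, ContDiff ℝ ∞ (g j) := fun j => (φ j).contDiff_normed_convolution hind
  have hglim : ∀ᵐ x ∂(volume.restrict T), Tendsto (fun j => g j x) atTop (𝓝 (v x)) := by
    have h0 : Tendsto (fun j : ℕ => r / ((j : ℝ) + 2)) atTop (𝓝 0) := by
      refine Tendsto.div_atTop tendsto_const_nhds ?_
      exact tendsto_atTop_add_const_right _ _ tendsto_natCast_atTop_atTop
    have h1 : Tendsto (fun j => (φ j).rOut) atTop (𝓝 0) := by
      have := (h0.const_mul κ).div_const 2
      simpa [hφ, coneBump] using this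
    have h2 := ContDiffBump.ae_convolution_tendsto_of_norm_center_le (φ := φ) (K := 2)
      (K' := 2 / κ) h1 (fun j => ?_) (fun j => ?_) hind
    · filter_upwards [ae_restrict_of_ae h2, ae_restrict_mem hTm] with x hx hxT
      rwa [indicator_of_mem hxT] at hx
    · change κ * (r / (j + 2)) / 2 ≤ 2 * (κ * (r / (j + 2)) / 4)
      linarith
    · change _ ≤ 2 / κ * (κ * (r / (j + 2)) / 2)
      rw [norm_neg, norm_smul, Real.norm_of_nonneg (hh0 j).le]
      have e1 : 2 / κ * (κ * (r / (j + 2)) / 2) = r / (j + 2) := by field_simp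
      rw [e1]
      exact mul_le_of_le_one_right (hh0 j).le hc.1
  set I : ℝ≥0∞ := ∫⁻ x in T, ‖(bdryWeight T x)⁻¹ * v x‖ₑ ^ 2 with hI
  have hIfin : I < ⊤ := by
    refine lt_of_le_of_lt (lintegral_mono fun x => pow_le_pow_left' ?_ 2)
      (eLpNorm_two_sq (μ := volume.restrict T) (g := weightedPair T v G) ▸
        ENNReal.pow_lt_top hm.2)
    rw [enorm_le_iff_norm_le]
    exact abs_inv_bdryWeight_mul_le v x
  choose j hj1 hj2 using fun k => exists_truncated_mollification_seq hT hb hf hvm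
    (fun j => (hgd j).continuous) hglim hIfin k
  set w : ℕ → Euc n → ℝ := fun k x => θ x * smoothTrunc (k + 1) (g (j k) x) with hw
  have hwd : ∀ k, ContDiff ℝ ∞ (w k) := fun k =>
    hθ.mul (contDiff_smoothTrunc.comp (hgd (j k)))
  have hwc : ∀ k, HasCompactSupport (w k) := fun k => hθc.mul_right
  obtain ⟨Θ₁, hΘ₁⟩ := hθc.exists_bound_of_continuous hθ.continuous
  obtain ⟨Θ₂, hΘ₂⟩ := (hθc.fderiv ℝ).exists_bound_of_continuous (hθ.continuous_fderiv (by simp))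
  set Θ : ℝ := max Θ₁ Θ₂ with hΘ
  have hΘ0 : 0 ≤ Θ := (norm_nonneg _).trans ((hΘ₁ 0).trans (le_max_left _ _))
  have hθle : ∀ x, |θ x| ≤ Θ := fun x => (hΘ₁ x).trans (le_max_left _ _)
  have hθle' : ∀ x, ‖∇ θ x‖ ≤ Θ := fun x => by
    rw [norm_gradient_eq]; exact (hΘ₂ x).trans (le_max_right _ _)
  -- the two terms that bound the weighted norm of the approximations
  set P : ℕ → Euc n → ℝ := fun k x =>
    (Θ * (1 + B ^ 2)) * ((bdryWeight T x)⁻¹ * smoothTrunc (k + 1) (g (j k) x)) with hP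
  set Q : ℕ → Euc n → ℝ := fun k => (Metric.ball p (r / 2)).indicator fun x =>
    Θ * (‖∇ (g (j k)) x‖ * bdryWeight T x) with hQ
  have hpt : ∀ k, ∀ x ∈ T, ‖weightedPair T (w k) (∇ (w k)) x‖ ≤ |P k x| + Q k x := by
    intro k x hx
    have hmx := bdryWeight_pos hT.isOpen hf hx
    set A := smoothTrunc (k + 1) (g (j k) x) with hA
    have hk : (0 : ℝ) < k + 1 := by positivity
    have h1 : ‖∇ (w k) x‖ ≤ |θ x| * ‖∇ (g (j k)) x‖ + |A| * ‖∇ θ x‖ := by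
      refine norm_gradient_mul_comp_le (hθ.differentiable (by simp) x)
        ((hgd (j k)).differentiable (by simp) x) (hasDerivAt_smoothTrunc hk _) ?_
      rw [abs_of_nonneg (by positivity), div_le_one (by positivity)]
      nlinarith [sq_nonneg (g (j k) x / ((k : ℝ) + 1))]
    have h2 : |θ x| * ‖∇ (g (j k)) x‖ * bdryWeight T x ≤ Q k x := by
      by_cases hxb : x ∈ Metric.ball p (r / 2)
      · rw [hQ]
        simp only [indicator_of_mem hxb]
        rw [mul_assoc]
        exact mul_le_mul_of_nonneg_right (hθle x) (by positivity)
      · have : θ x = 0 := image_eq_zero_of_notMem_tsupport fun h => hxb (hθs h)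
        rw [hQ]
        simp [indicator_of_notMem hxb, this]
    refine (norm_weightedPair_le _ _).trans ?_
    have h3 : |(bdryWeight T x)⁻¹ * w k x| ≤ Θ * ((bdryWeight T x)⁻¹ * |A|) := by
      rw [abs_mul, abs_of_pos (inv_pos.2 hmx)]
      have : |w k x| = |θ x| * |A| := abs_mul _ _
      rw [this]
      calc (bdryWeight T x)⁻¹ * (|θ x| * |A|) = |θ x| * ((bdryWeight T x)⁻¹ * |A|) := by ring
        _ ≤ Θ * ((bdryWeight T x)⁻¹ * |A|) := by
          gcongr
          exact hθle x
    have h4 : |P k x| = Θ * (1 + B ^ 2) * ((bdryWeight T x)⁻¹ * |A|) := by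
      rw [hP]
      simp only
      rw [abs_mul, abs_mul (bdryWeight T x)⁻¹, abs_of_nonneg (by positivity : 0 ≤ Θ * (1 + B ^ 2)),
        abs_of_pos (inv_pos.2 hmx)]
    have h5 : bdryWeight T x * (|A| * ‖∇ θ x‖) ≤ Θ * B ^ 2 * ((bdryWeight T x)⁻¹ * |A|) := by
      have e1 : bdryWeight T x = bdryWeight T x ^ 2 * (bdryWeight T x)⁻¹ := by field_simp
      have e2 : bdryWeight T x ^ 2 ≤ B ^ 2 := by
        have := hB x hx
        gcongr
      calc bdryWeight T x * (|A| * ‖∇ θ x‖)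
          = bdryWeight T x ^ 2 * ‖∇ θ x‖ * ((bdryWeight T x)⁻¹ * |A|) := by
            nth_rw 1 [e1]; ring
        _ ≤ B ^ 2 * Θ * ((bdryWeight T x)⁻¹ * |A|) := by
            have := hθle' x
            gcongr
        _ = _ := by ring
    have h6 := mul_le_mul_of_nonneg_left h1 hmx.le
    rw [h4]
    nlinarith
  have hPm : ∀ k, AEStronglyMeasurable (P k) (volume.restrict T) := fun k =>
    (measurable_const.mul (continuous_bdryWeight.measurable.inv.mul
      (contDiff_smoothTrunc.continuous.comp
        (hgd (j k)).continuous).measurable)).aestronglyMeasurable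
  have hQm : ∀ k, AEStronglyMeasurable (Q k) (volume.restrict T) := fun k =>
    ((measurable_const.mul ((hgd (j k)).continuous_gradient.norm.mul
      continuous_bdryWeight).measurable).indicator
        Metric.isOpen_ball.measurableSet).aestronglyMeasurable
  set J : ℝ≥0∞ := ∫⁻ x in T, (‖G x‖ₑ * ENNReal.ofReal (bdryWeight T x)) ^ 2 with hJ
  have hJfin : J < ⊤ := by
    refine lt_of_le_of_lt (lintegral_mono fun x => pow_le_pow_left' ?_ 2)
      (eLpNorm_two_sq (μ := volume.restrict T) (g := weightedPair T v G) ▸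
        ENNReal.pow_lt_top hm.2)
    rw [← Real.enorm_eq_ofReal (bdryWeight_nonneg x), ← enorm_norm (G x), ← enorm_mul,
      enorm_le_iff_norm_le]
    rw [norm_mul, norm_norm, Real.norm_of_nonneg (bdryWeight_nonneg x), mul_comm]
    exact bdryWeight_mul_norm_le v x
  set D₁ : ℝ≥0∞ := ‖Θ * (1 + B ^ 2)‖ₑ * (I + 1) with hD₁
  set D₂ : ℝ≥0∞ := ‖Θ‖ₑ * (C * J + 1) with hD₂
  have hle_sq : ∀ a : ℝ≥0∞, a + 1 ≤ (a + 1) ^ 2 := fun a => by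
    rw [sq]
    exact le_mul_of_one_le_left' (by simp)
  have hPn : ∀ k, eLpNorm (P k) 2 (volume.restrict T) ≤ D₁ := by
    intro k
    refine eLpNorm_two_le_of_lintegral_sq_le ?_
    simp only [hP, enorm_mul (Θ * (1 + B ^ 2)), mul_pow]
    rw [lintegral_const_mul' _ _ (ENNReal.pow_ne_top enorm_ne_top), hD₁, mul_pow]
    exact mul_le_mul' le_rfl ((hj1 k).trans (hle_sq _))
  have hQn : ∀ k, eLpNorm (Q k) 2 (volume.restrict T) ≤ D₂ := by
    intro k
    refine eLpNorm_two_le_of_lintegral_sq_le ?_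
    have e1 : ∀ x, ‖Q k x‖ₑ ^ 2 = ‖Θ‖ₑ ^ 2 * (Metric.ball p (r / 2)).indicator (fun x =>
        (‖∇ (g (j k)) x‖ₑ * ENNReal.ofReal (bdryWeight T x)) ^ 2) x := by
      intro x
      by_cases hxb : x ∈ Metric.ball p (r / 2)
      · simp only [hQ, indicator_of_mem hxb, enorm_mul, enorm_norm, mul_pow,
          Real.enorm_eq_ofReal (bdryWeight_nonneg x)]
      · simp [hQ, indicator_of_notMem hxb]
    simp only [e1]
    rw [lintegral_const_mul' _ _ (by simp),
      lintegral_indicator Metric.isOpen_ball.measurableSet,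
      Measure.restrict_restrict Metric.isOpen_ball.measurableSet, inter_comm, hD₂, mul_pow]
    refine mul_le_mul' le_rfl (le_trans ?_ ((le_add_right le_rfl).trans (hle_sq _)))
    refine hC _ (φ (j k)) (hh0 _) (hhr _) ?_
    change κ * (r / (j k + 2)) / 2 < κ * (r / (j k + 2))
    have := mul_pos hκ (hh0 (j k))
    linarith
  have hD : D₁ + D₂ ≠ ⊤ := by
    refine ENNReal.add_ne_top.2 ⟨ENNReal.mul_ne_top enorm_ne_top ?_,
      ENNReal.mul_ne_top enorm_ne_top ?_⟩
    · simpa using hIfin.ne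
    · simpa using ENNReal.mul_ne_top ENNReal.coe_ne_top hJfin.ne
  have hlimit := hv.smooth_mul hT.isOpen hθ
  refine PairMem.of_tendsto hT.isOpen hf hS (w := w) (W := fun k => ∇ (w k))
    (fun k => HasWeakGradientOn.of_contDiffOn hT.isOpen ((hwd k).of_le (by simp)).contDiffOn)
    (fun k => hsm _ (hwd k) (hwc k)) (C := (D₁ + D₂).toNNReal) (fun k => ?_) hlimit ?_ ?_
  · rw [ENNReal.coe_toNNReal hD]
    calc eLpNorm (weightedPair T (w k) (∇ (w k))) 2 (volume.restrict T)
        ≤ eLpNorm (fun x => ‖P k x‖ + Q k x) 2 (volume.restrict T) := by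
          refine eLpNorm_mono_ae_real ?_
          filter_upwards [ae_restrict_mem hTm] with x hx using hpt k x hx
      _ ≤ eLpNorm (fun x => ‖P k x‖) 2 (volume.restrict T)
          + eLpNorm (Q k) 2 (volume.restrict T) :=
          eLpNorm_add_le (hPm k).norm (hQm k) (by norm_num)
      _ ≤ D₁ + D₂ := by
          rw [eLpNorm_norm]
          exact add_le_add (hPn k) (hQn k)
  · refine MemLp.of_le_mul (c := Θ * (2 + B ^ 2)) hm hlimit.aestronglyMeasurable_weightedPair ?_
    filter_upwards [ae_restrict_mem hTm] with x hx
    have hmx := bdryWeight_pos hT.isOpen hf hx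
    refine (norm_weightedPair_le _ _).trans ?_
    have h1 := abs_inv_bdryWeight_mul_le (T := T) (G := G) v x
    have h2 := bdryWeight_mul_norm_le (T := T) (G := G) v x
    rw [abs_mul, abs_of_pos (inv_pos.2 hmx)] at h1
    set N := ‖weightedPair T v G x‖ with hN
    have h3 : |(bdryWeight T x)⁻¹ * (θ x * v x)| ≤ Θ * N := by
      rw [abs_mul, abs_mul, abs_of_pos (inv_pos.2 hmx)]
      calc (bdryWeight T x)⁻¹ * (|θ x| * |v x|) = |θ x| * ((bdryWeight T x)⁻¹ * |v x|) := by ring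
        _ ≤ Θ * N := mul_le_mul (hθle x) h1 (by positivity) hΘ0
    have h4 : bdryWeight T x * ‖θ x • G x + v x • ∇ θ x‖ ≤ Θ * N + B ^ 2 * Θ * N := by
      calc bdryWeight T x * ‖θ x • G x + v x • ∇ θ x‖
          ≤ bdryWeight T x * (|θ x| * ‖G x‖ + |v x| * ‖∇ θ x‖) := by
            gcongr
            refine (norm_add_le _ _).trans (le_of_eq ?_)
            rw [norm_smul, norm_smul, Real.norm_eq_abs, Real.norm_eq_abs]
        _ = |θ x| * (bdryWeight T x * ‖G x‖)
            + bdryWeight T x ^ 2 * ‖∇ θ x‖ * ((bdryWeight T x)⁻¹ * |v x|) := by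
            field_simp
        _ ≤ Θ * N + B ^ 2 * Θ * N := by
            have := hB x hx
            have := hθle x
            have := hθle' x
            gcongr
    linarith
  · intro ψ hψ hψc hψT
    obtain ⟨Ψ, hΨ⟩ := (hθc.mul_right (f' := ψ)).exists_bound_of_continuous
      (hθ.continuous.mul hψ.continuous)
    have hct : ∀ k : ℕ, Continuous (smoothTrunc ((k : ℝ) + 1)) := fun k =>
      contDiff_smoothTrunc.continuous
    have hbd : ∀ k : ℕ, ∀ x, ‖θ x * smoothTrunc (k + 1) (v x) * ψ x‖ ≤ Ψ * |v x| := by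
      intro k x
      have e1 : θ x * smoothTrunc (k + 1) (v x) * ψ x
          = (θ x * ψ x) * smoothTrunc (k + 1) (v x) := by ring
      rw [e1, norm_mul]
      exact mul_le_mul (hΨ x) (abs_smoothTrunc_le (by positivity) _) (norm_nonneg _)
        ((norm_nonneg _).trans (hΨ x))
    have hmeas : ∀ k : ℕ, AEStronglyMeasurable
        (fun x => θ x * smoothTrunc (k + 1) (v x) * ψ x) (volume.restrict T) := fun k =>
      (hθ.continuous.aestronglyMeasurable.mul
        ((hct k).comp_aestronglyMeasurable hvm)).mul hψ.continuous.aestronglyMeasurable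
    have hlim1 : Tendsto (fun k : ℕ => ∫ x in T, θ x * smoothTrunc (k + 1) (v x) * ψ x) atTop
        (𝓝 (∫ x in T, θ x * v x * ψ x)) := by
      refine tendsto_integral_of_dominated_convergence (fun x => Ψ * |v x|) hmeas
        (hvi.norm.const_mul Ψ) (fun k => Eventually.of_forall (hbd k)) ?_
      exact Eventually.of_forall fun x =>
        ((tendsto_smoothTrunc (v x)).const_mul _).mul_const _
    have hlim2 : Tendsto (fun k : ℕ => (∫ x in T, w k x * ψ x)
        - ∫ x in T, θ x * smoothTrunc (k + 1) (v x) * ψ x) atTop (𝓝 0) := by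
      have hΨ0 : 0 ≤ Ψ := (norm_nonneg _).trans (hΨ 0)
      refine squeeze_zero_norm (a := fun k : ℕ => Ψ * (1 / ((k : ℝ) + 1))) (fun k => ?_) ?_
      · have hk : (0 : ℝ) < k + 1 := by positivity
        have i1 : IntegrableOn (fun x => w k x * ψ x) T :=
          (((hwd k).continuous.mul hψ.continuous).integrable_of_hasCompactSupport
            (hwc k).mul_right).integrableOn
        have i2 : IntegrableOn (fun x => θ x * smoothTrunc (k + 1) (v x) * ψ x) T :=
          (hvi.norm.const_mul Ψ).mono' (hmeas k) (Eventually.of_forall (hbd k))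
        have i3 : IntegrableOn
            (fun x => |smoothTrunc (k + 1) (g (j k) x) - smoothTrunc (k + 1) (v x)|) T := by
          have : IsFiniteMeasure (volume.restrict T) := ⟨by simpa using hb.measure_lt_top⟩
          refine (integrable_const (2 * ((k : ℝ) + 1) + 2 * (k + 1))).mono'
            ((((hct k).comp (hgd (j k)).continuous).aestronglyMeasurable).sub
              ((hct k).comp_aestronglyMeasurable hvm)).norm (Eventually.of_forall fun x => ?_)
          rw [Real.norm_eq_abs, abs_abs]
          exact (abs_sub _ _).trans (add_le_add (abs_smoothTrunc_le_two_mul hk _)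
            (abs_smoothTrunc_le_two_mul hk _))
        rw [← integral_sub i1 i2]
        calc ‖∫ x in T, (w k x * ψ x - θ x * smoothTrunc (k + 1) (v x) * ψ x)‖
            ≤ ∫ x in T, Ψ * |smoothTrunc (k + 1) (g (j k) x) - smoothTrunc (k + 1) (v x)| := by
              refine norm_integral_le_of_norm_le (i3.const_mul Ψ) (Eventually.of_forall fun x => ?_)
              have e1 : w k x * ψ x - θ x * smoothTrunc (k + 1) (v x) * ψ x = (θ x * ψ x)
                  * (smoothTrunc (k + 1) (g (j k) x) - smoothTrunc (k + 1) (v x)) := by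
                simp only [hw]; ring
              rw [e1, norm_mul]
              exact mul_le_mul_of_nonneg_right (hΨ x) (norm_nonneg _)
          _ ≤ Ψ * (1 / ((k : ℝ) + 1)) := by
              rw [integral_const_mul]
              exact mul_le_mul_of_nonneg_left (hj2 k) hΨ0
      · simpa using tendsto_one_div_add_atTop_nhds_zero_nat.const_mul Ψ
    have := hlim2.add hlim1
    simpa using this

/-- In the weighted space on a bounded Lipschitz domain, a closed subspace that contains all test
functions contains everything. -/
theorem PairMem.of_forall_smooth (hT : IsLipschitzDomain T) (hb : Bornology.IsBounded T)
    (hf : (frontier T).Nonempty) (hS : IsClosed (S : Set (PairSpace T)))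
    (hsm : ∀ w : Euc n → ℝ, ContDiff ℝ ∞ w → HasCompactSupport w → PairMem S w (∇ w))
    (hv : HasWeakGradientOn T v G) (hm : MemLp (weightedPair T v G) 2 (volume.restrict T)) :
    PairMem S v G := by
  -- compactness replaces a partition of unity: cutoff functions for two sets `s` and `t` combine
  -- to the cutoff function `1 - (1 - θ₁) (1 - θ₂)` for `s ∪ t`
  have key : ∃ θ : Euc n → ℝ, ContDiff ℝ ∞ θ ∧ (∀ x ∈ closure T, θ x = 1) ∧
      ∀ η : Euc n → ℝ, ContDiff ℝ ∞ η → PairMem S (fun x => (η x * θ x) * v x)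
        (fun x => (η x * θ x) • G x + v x • ∇ (fun y => η y * θ y) x) := by
    refine IsCompact.induction_on (s := closure T) hb.isCompact_closure
      (p := fun s => ∃ θ : Euc n → ℝ, ContDiff ℝ ∞ θ ∧ (∀ x ∈ s, θ x = 1) ∧
      ∀ η : Euc n → ℝ, ContDiff ℝ ∞ η → PairMem S (fun x => (η x * θ x) * v x)
        (fun x => (η x * θ x) • G x + v x • ∇ (fun y => η y * θ y) x)) ?_ ?_ ?_ ?_
    · refine ⟨fun _ => 0, contDiff_const, by simp, fun η _ => ?_⟩
      have h0 := hsm (fun _ => 0) contDiff_const HasCompactSupport.zero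
      refine h0.congr hT.isOpen.measurableSet (fun x _ => by simp) fun x _ => ?_
      simp
    · rintro s t hst ⟨θ, h1, h2, h3⟩
      exact ⟨θ, h1, fun x hx => h2 x (hst hx), h3⟩
    · rintro s t ⟨θ₁, hd₁, he₁, hP₁⟩ ⟨θ₂, hd₂, he₂, hP₂⟩
      refine ⟨fun x => 1 - (1 - θ₁ x) * (1 - θ₂ x),
        contDiff_const.sub ((contDiff_const.sub hd₁).mul (contDiff_const.sub hd₂)), ?_, ?_⟩
      · rintro x (hx | hx)
        · simp [he₁ x hx]
        · simp [he₂ x hx]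
      · intro η hη
        have hc := ((hP₁ η hη).add (hP₂ η hη)).add (hP₂ _ (hη.mul hd₁)).neg
        refine hc.congr hT.isOpen.measurableSet (fun x _ => by ring) fun x _ => ?_
        have hA : DifferentiableAt ℝ (fun y => η y * θ₁ y) x :=
          (hη.mul hd₁).differentiable (by simp) x
        have hB : DifferentiableAt ℝ (fun y => η y * θ₂ y) x :=
          (hη.mul hd₂).differentiable (by simp) x
        have hC : DifferentiableAt ℝ (fun y => η y * θ₁ y * θ₂ y) x :=
          ((hη.mul hd₁).mul hd₂).differentiable (by simp) x
        have e1 : (fun y => η y * (1 - (1 - θ₁ y) * (1 - θ₂ y)))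
            = fun y => η y * θ₁ y + η y * θ₂ y - η y * θ₁ y * θ₂ y := by
          funext y; ring
        have e2 : ∇ (fun y => η y * (1 - (1 - θ₁ y) * (1 - θ₂ y))) x
            = ∇ (fun y => η y * θ₁ y) x + ∇ (fun y => η y * θ₂ y) x
              - ∇ (fun y => η y * θ₁ y * θ₂ y) x := by
          rw [e1]
          simp only [gradient]
          rw [fderiv_fun_sub (hA.fun_add hB) hC, fderiv_fun_add hA hB, map_sub, map_add]
        simp only
        rw [e2]
        module
    · intro p hp
      obtain ⟨e, r, κ, hc⟩ := hT.exists_coneCondition hp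
      have hr := hc.2.1
      let θ : ContDiffBump p := ⟨r / 8, r / 4, by positivity, by linarith⟩
      refine ⟨Metric.closedBall p (r / 8),
        mem_nhdsWithin_of_mem_nhds (Metric.closedBall_mem_nhds p (by positivity)),
        θ, θ.contDiff, fun x hx => θ.one_of_mem_closedBall hx, fun η hη => ?_⟩
      refine PairMem.smooth_mul_of_coneCondition hT hb hf hS hsm hv hm hc (hη.mul θ.contDiff)
        θ.hasCompactSupport.mul_left (tsupport_mul_subset_right.trans ?_)
      rw [θ.tsupport_eq]
      exact Metric.closedBall_subset_ball (by change r / 4 < r / 2; linarith)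
  obtain ⟨θ, hθ, hθ1, hP⟩ := key
  refine (hP (fun _ => 1) contDiff_const).congr hT.isOpen.measurableSet (fun x hx => ?_)
    fun x hx => ?_
  · simp [hθ1 x (subset_closure hx)]
  · have e1 : (fun y => 1 * θ y) =ᶠ[𝓝 x] fun _ => (1 : ℝ) := by
      filter_upwards [hT.isOpen.mem_nhds hx] with y hy
      rw [hθ1 y (subset_closure hy), one_mul]
    have e2 : ∇ (fun y => 1 * θ y) x = 0 := by
      rw [gradient, e1.fderiv_eq]; simp
    simp only
    rw [e2, hθ1 x (subset_closure hx)]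
    simp

end Density

/-! ### Approximation by restrictions of ambient smooth functions -/

section Ambient

variable {n : ℕ} {T : Set (Euc n)}

theorem memLp_inv_bdryWeight_add (hT : IsLipschitzDomain T) (hb : Bornology.IsBounded T)
    (hf : (frontier T).Nonempty) (B : ℝ) :
    MemLp (fun x => (bdryWeight T x)⁻¹ + B) 2 (volume.restrict T) := by
  have : IsFiniteMeasure (volume.restrict T) := ⟨by simpa using hb.measure_lt_top⟩
  refine MemLp.add ⟨continuous_bdryWeight.measurable.inv.aestronglyMeasurable, ?_⟩
    (memLp_const B)
  have h := lintegral_inv_bdryWeight_sq_lt_top hT hb hf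
  rw [← eLpNorm_two_sq] at h
  by_contra hcon
  rw [not_lt, top_le_iff] at hcon
  rw [hcon] at h
  simp at h

/-- Bounded functions with bounded gradients are bounded in the weighted norm. -/
theorem exists_eLpNorm_weightedPair_le (hT : IsLipschitzDomain T) (hb : Bornology.IsBounded T)
    (hf : (frontier T).Nonempty) (M : ℝ) :
    ∃ C : ℝ≥0, ∀ (u : Euc n → ℝ) (G : Euc n → Euc n),
      (∀ x ∈ T, |u x| ≤ M) → (∀ x ∈ T, ‖G x‖ ≤ M) →
      eLpNorm (weightedPair T u G) 2 (volume.restrict T) ≤ C := by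
  obtain ⟨B, hB0, hB⟩ := exists_bdryWeight_le_of_isBounded hb hf
  have hN := memLp_inv_bdryWeight_add hT hb hf B
  have hfin : ENNReal.ofReal M * eLpNorm (fun x => (bdryWeight T x)⁻¹ + B) 2 (volume.restrict T)
      ≠ ⊤ := ENNReal.mul_ne_top ENNReal.ofReal_ne_top hN.2.ne
  refine ⟨(ENNReal.ofReal M *
    eLpNorm (fun x => (bdryWeight T x)⁻¹ + B) 2 (volume.restrict T)).toNNReal, ?_⟩
  intro u G hu hG
  rw [ENNReal.coe_toNNReal hfin]
  refine eLpNorm_le_mul_eLpNorm_of_ae_le_mul ?_ 2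
  filter_upwards [ae_restrict_mem hT.isOpen.measurableSet] with x hx
  have hm := bdryWeight_pos hT.isOpen hf hx
  refine (norm_weightedPair_le _ _).trans ?_
  rw [abs_mul, abs_of_pos (inv_pos.2 hm), Real.norm_of_nonneg (by positivity)]
  have h1 : (bdryWeight T x)⁻¹ * |u x| ≤ (bdryWeight T x)⁻¹ * M := by
    have := hu x hx
    gcongr
  have h2 : bdryWeight T x * ‖G x‖ ≤ B * M :=
    mul_le_mul (hB x hx) (hG x hx) (norm_nonneg _) hB0.le
  linarith

theorem norm_gradient_le_of_lipschitzOn (hT : IsOpen T) {u : Euc n → ℝ} {K : ℝ≥0}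
    (hu : LipschitzOnWith K u T) {x : Euc n} (hx : x ∈ T) : ‖∇ u x‖ ≤ K := by
  rw [norm_gradient_eq]
  exact norm_fderiv_le_of_lipschitzOn ℝ (hT.mem_nhds hx) hu

/-- A Lipschitz function is uniformly approximated by smooth functions with the same Lipschitz
constant. -/
theorem LipschitzWith.exists_contDiff_approx {m : ℕ} {F : Euc m → ℝ} {K : ℝ≥0}
    (hF : LipschitzWith K F) {δ : ℝ} (hδ : 0 < δ) :
    ∃ f : Euc m → ℝ, ContDiff ℝ ∞ f ∧ LipschitzWith K f ∧ ∀ x, |f x - F x| ≤ K * δ := by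
  let φ : ContDiffBump (0 : Euc m) := ⟨δ / 2, δ, by positivity, by linarith⟩
  have hloc : LocallyIntegrable F := hF.continuous.locallyIntegrable
  have hint : ∀ x, Integrable fun t => φ.normed volume t * F (x - t) := by
    intro x
    refine Continuous.integrable_of_hasCompactSupport ?_ φ.hasCompactSupport_normed.mul_right
    exact φ.continuous_normed.mul (hF.continuous.comp (continuous_const.sub continuous_id))
  refine ⟨φ.normed volume ⋆[ContinuousLinearMap.lsmul ℝ ℝ, volume] F,
    φ.contDiff_normed_convolution hloc, ?_, ?_⟩
  · refine LipschitzWith.of_dist_le_mul fun x y => ?_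
    rw [dist_eq_norm, convolution_def, convolution_def]
    simp only [ContinuousLinearMap.lsmul_apply, smul_eq_mul]
    rw [← integral_sub (hint x) (hint y)]
    calc ‖∫ t, (φ.normed volume t * F (x - t) - φ.normed volume t * F (y - t))‖
        ≤ ∫ t, φ.normed volume t * (K * dist x y) := by
          refine norm_integral_le_of_norm_le (φ.integrable_normed.mul_const _)
            (Eventually.of_forall fun t => ?_)
          rw [← mul_sub, norm_mul, Real.norm_of_nonneg (φ.nonneg_normed t)]
          refine mul_le_mul_of_nonneg_left ?_ (φ.nonneg_normed t)
          have := hF.dist_le_mul (x - t) (y - t)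
          rwa [dist_sub_right, dist_eq_norm (F _)] at this
      _ = K * dist x y := by rw [integral_mul_const, φ.integral_normed, one_mul]
  · intro x
    have := φ.dist_normed_convolution_le (μ := volume) (g := F) (x₀ := x) (ε := K * δ)
      hF.continuous.aestronglyMeasurable fun y hy => by
        refine (hF.dist_le_mul y x).trans ?_
        exact mul_le_mul_of_nonneg_left (Metric.mem_ball.1 hy).le K.coe_nonneg
    rwa [Real.dist_eq] at this

variable {α : PartialEquiv (Euc (n + 1)) (Euc n)}

theorem IsBoundedHypersurface.isBounded_target (hα : IsBoundedHypersurface α) :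
    Bornology.IsBounded α.target := by
  obtain ⟨K, hK⟩ := hα.lipschitz
  obtain ⟨C, hC⟩ := Metric.isBounded_iff.1 hα.isBounded
  refine Metric.isBounded_iff.2 ⟨K * C, fun x hx y hy => ?_⟩
  have := hK.dist_le_mul _ (α.map_target hx) _ (α.map_target hy)
  rw [α.right_inv hx, α.right_inv hy] at this
  exact this.trans (mul_le_mul_of_nonneg_left
    (hC (α.map_target hx) (α.map_target hy)) K.coe_nonneg)

theorem IsBoundedHypersurface.contDiffOn_comp (hα : IsBoundedHypersurface α)
    {φ : Euc (n + 1) → ℝ} (hφ : ContDiff ℝ ∞ φ) : ContDiffOn ℝ 1 (φ ∘ α.symm) α.target :=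
  (hφ.of_le (by simp)).comp_contDiffOn hα.isDiffeo.contDiffOn_symm

theorem IsBoundedHypersurface.hasWeakGradientOn_comp (hα : IsBoundedHypersurface α)
    {φ : Euc (n + 1) → ℝ} (hφ : ContDiff ℝ ∞ φ) :
    HasWeakGradientOn α.target (φ ∘ α.symm) (∇ (φ ∘ α.symm)) :=
  .of_contDiffOn hα.lipschitzDomain.isOpen (hα.contDiffOn_comp hφ)

theorem gradient_congr_of_eqOn (hT : IsOpen T) {u u' : Euc n → ℝ} (h : EqOn u u' T) :
    EqOn (∇ u) (∇ u') T := by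
  intro x hx
  have : u =ᶠ[𝓝 x] u' := by
    filter_upwards [hT.mem_nhds hx] with y hy using h hy
  rw [gradient, gradient, this.fderiv_eq]

theorem IsBoundedHypersurface.memLp_weightedPair_comp (hα : IsBoundedHypersurface α)
    (hf : (frontier α.target).Nonempty) {φ : Euc (n + 1) → ℝ} (hφ : ContDiff ℝ ∞ φ)
    (hc : HasCompactSupport φ) :
    MemLp (weightedPair α.target (φ ∘ α.symm) (∇ (φ ∘ α.symm))) 2
      (volume.restrict α.target) := by
  obtain ⟨M, hM⟩ := hc.exists_bound_of_continuous hφ.continuous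
  obtain ⟨K, hK⟩ := hα.lipschitz_symm
  obtain ⟨L, hL⟩ := ContDiff.lipschitzWith_of_hasCompactSupport hc hφ (by simp)
  have hlip : LipschitzOnWith (L * K) (φ ∘ α.symm) α.target :=
    (hL.lipschitzOnWith (s := univ)).comp hK (mapsTo_univ _ _)
  obtain ⟨C, hC⟩ := exists_eLpNorm_weightedPair_le hα.lipschitzDomain hα.isBounded_target hf
    (max M ((L * K : ℝ≥0) : ℝ))
  have hw := hα.hasWeakGradientOn_comp hφ
  refine ⟨hw.aestronglyMeasurable_weightedPair, (hC _ _ (fun x _ => ?_) fun x hx => ?_).trans_lt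
    ENNReal.coe_lt_top⟩
  · exact (hM _).trans (le_max_left _ _)
  · exact (norm_gradient_le_of_lipschitzOn hα.lipschitzDomain.isOpen hlip hx).trans
      (le_max_right _ _)

/-- The subspace of the pairs `(φ ∘ α⁻¹, ∇ (φ ∘ α⁻¹))` for test functions `φ` of the ambient
space. -/
def ambientPairs (α : PartialEquiv (Euc (n + 1)) (Euc n)) (hα : IsBoundedHypersurface α) :
    Submodule ℝ (PairSpace α.target) where
  carrier := {y | ∃ φ : Euc (n + 1) → ℝ, ContDiff ℝ ∞ φ ∧ HasCompactSupport φ ∧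
    y =ᵐ[volume.restrict α.target] weightedPair α.target (φ ∘ α.symm) (∇ (φ ∘ α.symm))}
  add_mem' := by
    rintro y z ⟨φ, hφ, hc, hy⟩ ⟨ψ, hψ, hc', hz⟩
    refine ⟨fun x => φ x + ψ x, hφ.add hψ, hc.add hc', ?_⟩
    have hT := hα.lipschitzDomain.isOpen
    filter_upwards [hy, hz, Lp.coeFn_add y z, ae_restrict_mem hT.measurableSet] with x h1 h2 h3 hx
    have d1 := ((hα.contDiffOn_comp hφ).differentiableOn (by simp)).differentiableAt
      (hT.mem_nhds hx)
    have d2 := ((hα.contDiffOn_comp hψ).differentiableOn (by simp)).differentiableAt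
      (hT.mem_nhds hx)
    have e : ∇ ((fun x => φ x + ψ x) ∘ α.symm) x = ∇ (φ ∘ α.symm) x + ∇ (ψ ∘ α.symm) x := by
      have e0 : (fun x => φ x + ψ x) ∘ α.symm = (φ ∘ α.symm) + (ψ ∘ α.symm) := rfl
      rw [e0, gradient, gradient, gradient, fderiv_add d1 d2, map_add]
    rw [h3, Pi.add_apply, h1, h2]
    simp only [weightedPair]
    rw [e, ← WithLp.toLp_add, Prod.mk_add_mk, ← mul_add, ← smul_add]
    rfl
  zero_mem' := by
    refine ⟨fun _ => 0, contDiff_const, HasCompactSupport.zero, ?_⟩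
    filter_upwards [Lp.coeFn_zero (WithLp 2 (ℝ × Euc n)) 2 (volume.restrict α.target)] with x hx
    have e : ∇ ((fun _ : Euc (n + 1) => (0 : ℝ)) ∘ α.symm) x = 0 := by
      have e0 : (fun _ : Euc (n + 1) => (0 : ℝ)) ∘ α.symm = fun _ => 0 := rfl
      rw [e0, gradient]; simp
    rw [hx, weightedPair, e]
    simp
    rfl
  smul_mem' := by
    rintro c y ⟨φ, hφ, hc, hy⟩
    refine ⟨fun x => c * φ x, contDiff_const.mul hφ, hc.mul_left, ?_⟩
    have hT := hα.lipschitzDomain.isOpen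
    filter_upwards [hy, Lp.coeFn_smul c y, ae_restrict_mem hT.measurableSet] with x h1 h3 hx
    have d1 := ((hα.contDiffOn_comp hφ).differentiableOn (by simp)).differentiableAt
      (hT.mem_nhds hx)
    have e : ∇ ((fun x => c * φ x) ∘ α.symm) x = c • ∇ (φ ∘ α.symm) x := by
      have e0 : (fun x => c * φ x) ∘ α.symm = c • (φ ∘ α.symm) := rfl
      rw [e0, gradient, gradient, fderiv_const_smul d1, map_smul]
    rw [h3, Pi.smul_apply, h1]
    simp only [weightedPair]
    rw [e, ← WithLp.toLp_smul, Prod.smul_mk, smul_comm c]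
    simp only [Function.comp_apply, smul_eq_mul]
    rw [mul_left_comm]

/-- A test function of the parameter domain is a limit of restrictions of ambient test functions:
extend it from the hypersurface as a Lipschitz function and mollify in the ambient space. Gradients
merely stay bounded here, and the weak limit argument does the rest. -/
theorem IsBoundedHypersurface.pairMem_of_smooth (hα : IsBoundedHypersurface α)
    (hf : (frontier α.target).Nonempty) {w : Euc n → ℝ} (hw : ContDiff ℝ ∞ w)
    (hc : HasCompactSupport w) :
    PairMem (ambientPairs α hα).topologicalClosure w (∇ w) := by
  have hT := hα.lipschitzDomain.isOpen
  have hb := hα.isBounded_target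
  obtain ⟨K₁, hK₁⟩ := hα.lipschitz
  obtain ⟨K₂, hK₂⟩ := hα.lipschitz_symm
  obtain ⟨L, hL⟩ := ContDiff.lipschitzWith_of_hasCompactSupport hc hw (by simp)
  obtain ⟨M, hM⟩ := hc.exists_bound_of_continuous hw.continuous
  obtain ⟨F, hF, hFw⟩ :=
    ((hL.lipschitzOnWith (s := univ)).comp hK₁ (mapsTo_univ _ _)).extend_real
  have hFβ : ∀ x ∈ α.target, F (α.symm x) = w x := by
    intro x hx
    rw [← hFw (α.map_target hx), Function.comp_apply, α.right_inv hx]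
  choose f hfd hfl hfF using fun k : ℕ =>
    hF.exists_contDiff_approx (show (0 : ℝ) < 1 / ((k : ℝ) + 1) by positivity)
  obtain ⟨R, hR0, hR⟩ := hα.isBounded.subset_ball_lt 0 0
  let χ : ContDiffBump (0 : Euc (n + 1)) := ⟨R, R + 1, hR0, by linarith⟩
  have hχ : ∀ x ∈ α.target, χ (α.symm x) = 1 := fun x hx =>
    χ.one_of_mem_closedBall (Metric.ball_subset_closedBall (hR (α.map_target hx)))
  set g : ℕ → Euc (n + 1) → ℝ := fun k x => χ x * f k x with hg
  have hgd : ∀ k, ContDiff ℝ ∞ (g k) := fun k => χ.contDiff.mul (hfd k)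
  have hgc : ∀ k, HasCompactSupport (g k) := fun k => χ.hasCompactSupport.mul_right
  have hgf : ∀ k, EqOn (g k ∘ α.symm) (f k ∘ α.symm) α.target := fun k x hx => by
    simp [hg, hχ x hx]
  have hgw : ∀ k, ∀ x ∈ α.target, |g k (α.symm x) - w x| ≤
      (L * K₁ : ℝ≥0) * (1 / ((k : ℝ) + 1)) := by
    intro k x hx
    have := hgf k hx
    simp only [Function.comp_apply] at this
    rw [this, ← hFβ x hx]
    exact hfF k _
  have hwg : HasWeakGradientOn α.target w (∇ w) :=
    .of_contDiffOn hT (hw.of_le (by simp)).contDiffOn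
  set N : ℝ := max (M + (L * K₁ : ℝ≥0)) (L * K₁ * K₂ : ℝ≥0) with hN
  have hbound : ∀ k, ∀ x ∈ α.target, |g k (α.symm x)| ≤ N := by
    intro k x hx
    have h1 := hgw k x hx
    have h2 : |w x| ≤ M := hM x
    have h3 : (1 : ℝ) / (k + 1) ≤ 1 := by
      rw [div_le_one (by positivity)]
      linarith [(Nat.cast_nonneg k : (0 : ℝ) ≤ k)]
    have h4 : ((L * K₁ : ℝ≥0) : ℝ) * (1 / ((k : ℝ) + 1)) ≤ (L * K₁ : ℝ≥0) :=
      mul_le_of_le_one_right (NNReal.coe_nonneg _) h3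
    have h5 : |g k (α.symm x)| ≤ |g k (α.symm x) - w x| + |w x| := by
      simpa using abs_add_le (g k (α.symm x) - w x) (w x)
    exact (h5.trans (by linarith)).trans (le_max_left _ _)
  have hgrad : ∀ k, ∀ x ∈ α.target, ‖∇ (g k ∘ α.symm) x‖ ≤ N := by
    intro k x hx
    rw [gradient_congr_of_eqOn hT (hgf k) hx]
    have hlip : LipschitzOnWith (L * K₁ * K₂) (f k ∘ α.symm) α.target :=
      ((hfl k).lipschitzOnWith (s := univ)).comp hK₂ (mapsTo_univ _ _)
    exact (norm_gradient_le_of_lipschitzOn hT hlip hx).trans (le_max_right _ _)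
  obtain ⟨C, hC⟩ := exists_eLpNorm_weightedPair_le hα.lipschitzDomain hb hf N
  obtain ⟨C', hC'⟩ := exists_eLpNorm_weightedPair_le hα.lipschitzDomain hb hf
    (max M (L : ℝ))
  refine PairMem.of_tendsto hT hf (Submodule.isClosed_topologicalClosure _)
    (w := fun k => g k ∘ α.symm) (W := fun k => ∇ (g k ∘ α.symm))
    (fun k => hα.hasWeakGradientOn_comp (hgd k)) (fun k => ?_) (C := C)
    (fun k => hC _ _ (hbound k) (hgrad k)) hwg
    ⟨hwg.aestronglyMeasurable_weightedPair, (hC' _ _ (fun x _ => ?_)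
      fun x hx => ?_).trans_lt ENNReal.coe_lt_top⟩ ?_
  · have hm := hα.memLp_weightedPair_comp hf (hgd k) (hgc k)
    exact ⟨hm, Submodule.le_topologicalClosure _ ⟨g k, hgd k, hgc k, hm.coeFn_toLp⟩⟩
  · exact (hM x).trans (le_max_left _ _)
  · exact (norm_gradient_le_of_lipschitzOn hT (hL.lipschitzOnWith (s := α.target)) hx).trans
      (le_max_right _ _)
  · intro φ hφ hφc hφs
    have hφi : IntegrableOn φ α.target :=
      (hφ.continuous.integrable_of_hasCompactSupport hφc).integrableOn
    have i1 : ∀ k, IntegrableOn (fun x => g k (α.symm x) * φ x) α.target := by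
      intro k
      have h := (hα.hasWeakGradientOn_comp (hgd k)).locallyIntegrableOn
      have := h.integrable_smul_of_tsupport_subset hφ.continuous hφc hφs
      refine (this.congr (Eventually.of_forall fun x => ?_)).integrableOn
      simp [mul_comm]
    have i2 : IntegrableOn (fun x => w x * φ x) α.target :=
      ((hw.continuous.mul hφ.continuous).integrable_of_hasCompactSupport hφc.mul_left).integrableOn
    rw [tendsto_iff_norm_sub_tendsto_zero]
    refine squeeze_zero (fun k => norm_nonneg _) (g := fun k : ℕ =>
      (L * K₁ : ℝ≥0) * (1 / ((k : ℝ) + 1)) * ∫ x in α.target, |φ x|) (fun k => ?_) ?_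
    · simp only [Function.comp_apply]
      rw [← integral_sub (i1 k) i2, ← integral_const_mul]
      refine norm_integral_le_of_norm_le (hφi.norm.const_mul _) ?_
      filter_upwards [ae_restrict_mem hT.measurableSet] with x hx
      rw [← sub_mul, norm_mul]
      exact mul_le_mul_of_nonneg_right (hgw k x hx) (norm_nonneg _)
    · have := (tendsto_one_div_add_atTop_nhds_zero_nat (𝕜 := ℝ)).const_mul ((L * K₁ : ℝ≥0) : ℝ)
      simpa using this.mul_const (∫ x in α.target, |φ x|)

/-- Density on the parameter domain, with the weights `dist(·, ∂T)^(-1/2)` and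
`dist(·, ∂T)^(1/2)`. -/
theorem IsBoundedHypersurface.exists_eLpNorm_weightedPair_sub_lt (hα : IsBoundedHypersurface α)
    (hf : (frontier α.target).Nonempty) {v : Euc n → ℝ} {G : Euc n → Euc n}
    (hv : HasWeakGradientOn α.target v G)
    (hm : MemLp (weightedPair α.target v G) 2 (volume.restrict α.target)) {δ : ℝ} (hδ : 0 < δ) :
    ∃ φ : Euc (n + 1) → ℝ, ContDiff ℝ ∞ φ ∧ HasCompactSupport φ ∧
      eLpNorm (weightedPair α.target (fun x => v x - φ (α.symm x))
        (fun x => G x - ∇ (φ ∘ α.symm) x)) 2 (volume.restrict α.target) < ENNReal.ofReal δ := by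
  obtain ⟨hm', hmem⟩ := PairMem.of_forall_smooth hα.lipschitzDomain hα.isBounded_target hf
    (Submodule.isClosed_topologicalClosure (ambientPairs α hα))
    (fun w hw hc => hα.pairMem_of_smooth hf hw hc) hv hm
  obtain ⟨y, ⟨φ, hφ, hc, hy⟩, hlt⟩ := Metric.mem_closure_iff.1
    (show hm'.toLp _ ∈ closure (ambientPairs α hα : Set (PairSpace α.target)) from hmem) δ hδ
  refine ⟨φ, hφ, hc, ?_⟩
  rw [Lp.dist_def] at hlt
  have hae : ⇑(hm'.toLp _) - ⇑y =ᵐ[volume.restrict α.target]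
      weightedPair α.target (fun x => v x - φ (α.symm x)) (fun x => G x - ∇ (φ ∘ α.symm) x) := by
    filter_upwards [hm'.coeFn_toLp, hy] with x h1 h2
    rw [Pi.sub_apply, h1, h2]
    simp only [weightedPair]
    rw [← WithLp.toLp_sub, Prod.mk_sub_mk, ← mul_sub, ← smul_sub]
    rfl
  rw [eLpNorm_congr_ae hae] at hlt
  refine (ENNReal.lt_ofReal_iff_toReal_lt ?_).2 hlt
  rw [← eLpNorm_congr_ae hae]
  exact ((Lp.memLp _).sub (Lp.memLp _)).2.ne

end Ambient

/-! ### The weight on the hypersurface -/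

section Weight

variable {n : ℕ} {α : PartialEquiv (Euc (n + 1)) (Euc n)}

/-- The distance to the boundary in the parameter domain is controlled by the distance to `γ`,
because a sequence on the hypersurface tending to a point of `γ` has parameters tending to a point
of `∂T`. -/
theorem IsBoundedHypersurface.infDist_frontier_le (hα : IsBoundedHypersurface α) {K : ℝ≥0}
    (hK : LipschitzOnWith K α α.source) {x : Euc n} (hx : x ∈ α.target) {y : Euc (n + 1)}
    (hy : y ∈ bdry α) : Metric.infDist x (frontier α.target) ≤ K * dist (α.symm x) y := by
  obtain ⟨hyc, hyn⟩ := hy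
  obtain ⟨s, hs, hsy⟩ := mem_closure_iff_seq_limit.1 hyc
  have hcs : CauchySeq fun k => α (s k) := by
    rw [Metric.cauchySeq_iff']
    intro ε hε
    obtain ⟨N, hN⟩ := Metric.cauchySeq_iff'.1 hsy.cauchySeq (ε / (K + 1)) (by positivity)
    refine ⟨N, fun k hk => (hK.dist_le_mul _ (hs k) _ (hs N)).trans_lt ?_⟩
    have h1 := hN k hk
    rw [lt_div_iff₀ (by positivity)] at h1
    have h2 : 0 ≤ dist (s k) (s N) := dist_nonneg
    nlinarith [K.coe_nonneg]
  obtain ⟨z, hz⟩ := cauchySeq_tendsto_of_complete hcs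
  have hzc : z ∈ closure α.target :=
    mem_closure_of_tendsto hz (Eventually.of_forall fun k => α.map_source (hs k))
  have hzn : z ∉ α.target := by
    intro hzt
    have hcont : ContinuousAt α.symm z := (hα.isDiffeo.contDiffOn_symm.continuousOn).continuousAt
      (hα.lipschitzDomain.isOpen.mem_nhds hzt)
    have h1 : Tendsto (fun k => α.symm (α (s k))) atTop (𝓝 (α.symm z)) := hcont.tendsto.comp hz
    simp only [α.left_inv (hs _)] at h1
    rw [tendsto_nhds_unique hsy h1] at hyn
    exact hyn (α.map_target hzt)
  have hzf : z ∈ frontier α.target := by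
    rw [hα.lipschitzDomain.isOpen.frontier_eq]; exact ⟨hzc, hzn⟩
  refine (Metric.infDist_le_dist_of_mem hzf).trans ?_
  refine le_of_tendsto_of_tendsto (tendsto_const_nhds.dist hz)
    ((tendsto_const_nhds.dist hsy).const_mul (K : ℝ)) (Eventually.of_forall fun k => ?_)
  have := hK.dist_le_mul _ (α.map_target hx) _ (hs k)
  rwa [α.right_inv hx] at this

theorem IsBoundedHypersurface.exists_mem_bdry_dist_le (hα : IsBoundedHypersurface α) {K : ℝ≥0}
    (hK : LipschitzOnWith K α.symm α.target) {x : Euc n} (hx : x ∈ α.target) {z : Euc n}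
    (hz : z ∈ frontier α.target) : ∃ y ∈ bdry α, dist (α.symm x) y ≤ K * dist x z := by
  rw [hα.lipschitzDomain.isOpen.frontier_eq] at hz
  obtain ⟨hzc, hzn⟩ := hz
  obtain ⟨s, hs, hsz⟩ := mem_closure_iff_seq_limit.1 hzc
  have hcs : CauchySeq fun k => α.symm (s k) := by
    rw [Metric.cauchySeq_iff']
    intro ε hε
    obtain ⟨N, hN⟩ := Metric.cauchySeq_iff'.1 hsz.cauchySeq (ε / (K + 1)) (by positivity)
    refine ⟨N, fun k hk => (hK.dist_le_mul _ (hs k) _ (hs N)).trans_lt ?_⟩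
    have h1 := hN k hk
    rw [lt_div_iff₀ (by positivity)] at h1
    have h2 : 0 ≤ dist (s k) (s N) := dist_nonneg
    nlinarith [K.coe_nonneg]
  obtain ⟨y, hy⟩ := cauchySeq_tendsto_of_complete hcs
  have hyc : y ∈ closure α.source :=
    mem_closure_of_tendsto hy (Eventually.of_forall fun k => α.map_target (hs k))
  have hyn : y ∉ α.source := by
    intro hys
    obtain ⟨K₁, hK₁⟩ := hα.lipschitz
    have hcont := hK₁.continuousOn y hys
    have h1 : Tendsto (fun k => α (α.symm (s k))) atTop (𝓝 (α y)) :=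
      hcont.tendsto.comp (tendsto_nhdsWithin_iff.2
        ⟨hy, Eventually.of_forall fun k => α.map_target (hs k)⟩)
    simp only [α.right_inv (hs _)] at h1
    rw [tendsto_nhds_unique hsz h1] at hzn
    exact hzn (α.map_source hys)
  refine ⟨y, ⟨hyc, hyn⟩, ?_⟩
  exact le_of_tendsto_of_tendsto (tendsto_const_nhds.dist hy)
    ((tendsto_const_nhds.dist hsz).const_mul (K : ℝ))
    (Eventually.of_forall fun k => hK.dist_le_mul _ hx _ (hs k))

theorem IsBoundedHypersurface.isCompact_bdry (hα : IsBoundedHypersurface α)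
    (hf : (frontier α.target).Nonempty) : IsCompact (bdry α) := by
  have hbd : Bornology.IsBounded (bdry α) := hα.isBounded.closure.subset sdiff_subset
  refine Metric.isCompact_of_isClosed_isBounded ?_ hbd
  -- a limit in the hypersurface would have distance `0` from the boundary of the parameter domain
  obtain ⟨K, hK⟩ := hα.lipschitz
  rw [← isOpen_compl_iff, Metric.isOpen_iff]
  intro y hy
  by_cases hys : y ∈ α.source
  · have hpos := infDist_frontier_pos hα.lipschitzDomain.isOpen hf (α.map_source hys)
    refine ⟨Metric.infDist (α y) (frontier α.target) / (K + 1), by positivity, fun z hz hzb => ?_⟩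
    have h1 := hα.infDist_frontier_le hK (α.map_source hys) hzb
    rw [α.left_inv hys, dist_comm] at h1
    rw [Metric.mem_ball, lt_div_iff₀ (by positivity)] at hz
    have h2 : 0 ≤ dist z y := dist_nonneg
    nlinarith [K.coe_nonneg]
  · have hyc : y ∉ closure α.source := fun h => hy ⟨h, hys⟩
    obtain ⟨ρ, hρ, hsub⟩ := Metric.isOpen_iff.1 (isClosed_closure (s := α.source)).isOpen_compl y
      hyc
    exact ⟨ρ, hρ, fun z hz hzb => hsub hz hzb.1⟩

/-- Under the assumptions on the width, `b ∘ α⁻¹` is comparable to `dist(·, ∂T)^(1/2)` on the whole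
parameter domain. -/
theorem WidthAssumptions.exists_comparison {b χ f : Euc (n + 1) → ℝ} (hn : 1 ≤ n)
    (hα : IsBoundedHypersurface α) (hb : WidthAssumptions α b χ f) :
    ∃ c₁ c₂ : ℝ, 0 < c₁ ∧ 0 < c₂ ∧ ∀ᵐ x ∂(volume.restrict α.target),
      c₁ * bdryWeight α.target x ^ 2 ≤ b (α.symm x) ∧
        b (α.symm x) ≤ c₂ * bdryWeight α.target x ^ 2 := by
  have hT := hα.lipschitzDomain.isOpen
  have hf := frontier_nonempty_of_isBounded hn hα.lipschitzDomain.isConnected.nonempty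
    hα.isBounded_target
  obtain ⟨c, hc, hform⟩ := hb.formula
  obtain ⟨bmax, hbmax, hbm⟩ := hb.bounded
  obtain ⟨a, ha, hfa⟩ := hb.lower_bound
  obtain ⟨K₁, hK₁⟩ := hα.lipschitz
  obtain ⟨K₂, hK₂⟩ := hα.lipschitz_symm
  obtain ⟨B, hB0, hB⟩ := exists_bdryWeight_le_of_isBounded hα.isBounded_target hf
  have hcpt := hα.isCompact_bdry hf
  obtain ⟨x₀, hx₀⟩ := hα.lipschitzDomain.isConnected.nonempty
  have hne : (bdry α).Nonempty := by
    obtain ⟨z, hz⟩ := hf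
    obtain ⟨y, hy, -⟩ := hα.exists_mem_bdry_dist_le hK₂ hx₀ hz
    exact ⟨y, hy⟩
  obtain ⟨δ, hδ, hδχ⟩ : ∃ δ, 0 < δ ∧ ∀ s, Metric.infDist s (bdry α) < δ → χ s = 1 := by
    obtain ⟨U, hU, hγU, hUχ⟩ := eventually_nhdsSet_iff_exists.1 hb.cutoff_eq_one
    obtain ⟨δ, hδ, hsub⟩ := hcpt.exists_thickening_subset_open hU hγU
    refine ⟨δ, hδ, fun s hs => hUχ s (hsub ?_)⟩
    rw [Metric.mem_thickening_iff]
    obtain ⟨y, hy, hys⟩ := (Metric.infDist_lt_iff hne).1 hs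
    exact ⟨y, hy, hys⟩
  set κ₁ : ℝ := K₁ + 1 with hκ₁
  set κ₂ : ℝ := K₂ + 1 with hκ₂
  have hκ₁0 : 0 < κ₁ := by positivity
  have hκ₂0 : 0 < κ₂ := by positivity
  have hd1 : ∀ x ∈ α.target, Metric.infDist x (frontier α.target)
      ≤ κ₁ * Metric.infDist (α.symm x) (bdry α) := by
    intro x hx
    rw [← div_le_iff₀' hκ₁0, Metric.le_infDist hne]
    intro y hy
    rw [div_le_iff₀' hκ₁0]
    refine (hα.infDist_frontier_le hK₁ hx hy).trans ?_
    exact mul_le_mul_of_nonneg_right (by linarith) dist_nonneg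
  have hd2 : ∀ x ∈ α.target, Metric.infDist (α.symm x) (bdry α)
      ≤ κ₂ * Metric.infDist x (frontier α.target) := by
    intro x hx
    rw [← div_le_iff₀' hκ₂0, Metric.le_infDist hf]
    intro z hz
    rw [div_le_iff₀' hκ₂0]
    obtain ⟨y, hy, hyz⟩ := hα.exists_mem_bdry_dist_le hK₂ hx hz
    refine (Metric.infDist_le_dist_of_mem hy).trans (hyz.trans ?_)
    exact mul_le_mul_of_nonneg_right (by linarith) dist_nonneg
  set μ : ℝ := min √δ a with hμ
  have hμ0 : 0 < μ := lt_min (Real.sqrt_pos.2 hδ) ha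
  have hm1 : ∀ x ∈ α.target, bdryWeight α.target x ^ 2
      ≤ √κ₁ * √(Metric.infDist (α.symm x) (bdry α)) := by
    intro x hx
    rw [bdryWeight_sq, ← Real.sqrt_mul hκ₁0.le]
    exact Real.sqrt_le_sqrt (hd1 x hx)
  have hm2 : ∀ x ∈ α.target, √(Metric.infDist (α.symm x) (bdry α))
      ≤ √κ₂ * bdryWeight α.target x ^ 2 := by
    intro x hx
    rw [bdryWeight_sq, ← Real.sqrt_mul hκ₂0.le]
    exact Real.sqrt_le_sqrt (hd2 x hx)
  have hsκ₁ : 0 < √κ₁ := Real.sqrt_pos.2 hκ₁0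
  have hsκ₂ : 0 < √κ₂ := Real.sqrt_pos.2 hκ₂0
  have hsδ : 0 < √δ := Real.sqrt_pos.2 hδ
  refine ⟨min (c / √κ₁) (c * μ / B ^ 2), max (c * √κ₂) (bmax * √κ₂ / √δ),
    lt_min (by positivity) (by positivity), lt_max_of_lt_left (by positivity), ?_⟩
  filter_upwards [hbm, hfa, ae_restrict_mem hT.measurableSet] with x h1 h2 hx
  have hmp := bdryWeight_pos hT hf hx
  have hsq : 0 < bdryWeight α.target x ^ 2 := by positivity
  have hx1 := hm1 x hx
  have hx2 := hm2 x hx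
  have hb' := hform _ (α.map_target hx)
  set D := √(Metric.infDist (α.symm x) (bdry α)) with hD
  rcases lt_or_ge (Metric.infDist (α.symm x) (bdry α)) δ with hlt | hge
  · have hχ1 := hδχ _ hlt
    rw [hχ1] at hb'
    have hb2 : b (α.symm x) = c * D := by rw [hb']; ring
    rw [hb2]
    constructor
    · calc min (c / √κ₁) (c * μ / B ^ 2) * bdryWeight α.target x ^ 2
          ≤ c / √κ₁ * (√κ₁ * D) := mul_le_mul (min_le_left _ _) hx1 hsq.le (by positivity)
        _ = c * D := by field_simp
    · calc c * D ≤ c * (√κ₂ * bdryWeight α.target x ^ 2) := by gcongr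
        _ = (c * √κ₂) * bdryWeight α.target x ^ 2 := by ring
        _ ≤ _ := by gcongr; exact le_max_left _ _
  · have hDδ : √δ ≤ D := Real.sqrt_le_sqrt hge
    have hχm := hb.cutoff_mem (α.symm x)
    constructor
    · have h3 : μ ≤ χ (α.symm x) * D + (1 - χ (α.symm x)) * f (α.symm x) := by
        have h4 : μ ≤ D := (min_le_left _ _).trans hDδ
        have h5 : μ ≤ f (α.symm x) := (min_le_right _ _).trans h2
        nlinarith [hχm.1, hχm.2]
      have h6 : bdryWeight α.target x ^ 2 ≤ B ^ 2 := by
        have := hB x hx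
        gcongr
      rw [hb']
      calc min (c / √κ₁) (c * μ / B ^ 2) * bdryWeight α.target x ^ 2
          ≤ (c * μ / B ^ 2) * B ^ 2 := mul_le_mul (min_le_right _ _) h6 hsq.le (by positivity)
        _ = c * μ := by field_simp
        _ ≤ _ := by gcongr
    · calc b (α.symm x) ≤ bmax := (le_abs_self _).trans h1
        _ = bmax / √δ * √δ := by field_simp
        _ ≤ bmax / √δ * (√κ₂ * bdryWeight α.target x ^ 2) := by
          gcongr
          exact hDδ.trans hx2
        _ = (bmax * √κ₂ / √δ) * bdryWeight α.target x ^ 2 := by ring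
        _ ≤ _ := by gcongr; exact le_max_right _ _

end Weight

/-! ### Tangential gradients and gradients in the chart -/

section Tangential

variable {n : ℕ} {α : PartialEquiv (Euc (n + 1)) (Euc n)}

theorem IsBoundedHypersurface.hasFDerivAt_symm (hα : IsBoundedHypersurface α) {x : Euc n}
    (hx : x ∈ α.target) : HasFDerivAt α.symm (fderiv ℝ α.symm x) x :=
  ((hα.isDiffeo.contDiffOn_symm.differentiableOn (by simp)).differentiableAt
    (hα.lipschitzDomain.isOpen.mem_nhds hx)).hasFDerivAt

theorem IsBoundedHypersurface.continuousOn_fderiv_symm (hα : IsBoundedHypersurface α) :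
    ContinuousOn (fderiv ℝ α.symm) α.target :=
  hα.isDiffeo.contDiffOn_symm.continuousOn_fderiv_of_isOpen hα.lipschitzDomain.isOpen le_rfl

/-- As `α` is Lipschitz, the derivative of the parametrization is bounded below. -/
theorem IsBoundedHypersurface.norm_le_mul_norm_fderiv_symm (hα : IsBoundedHypersurface α)
    {K : ℝ≥0} (hK : LipschitzOnWith K α α.source) {x : Euc n} (hx : x ∈ α.target) (h : Euc n) :
    ‖h‖ ≤ K * ‖fderiv ℝ α.symm x h‖ := by
  have h1 := (hα.hasFDerivAt_symm hx).hasLineDerivAt h |>.tendsto_slope_zero_right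
  have h2 : Tendsto (fun t : ℝ => x + t • h) (𝓝[>] 0) (𝓝 x) := by
    have : ContinuousAt (fun t : ℝ => x + t • h) 0 := by fun_prop
    have h3 := this.tendsto
    simp only [zero_smul, add_zero] at h3
    exact h3.mono_left nhdsWithin_le_nhds
  refine ge_of_tendsto (h1.norm.const_mul (K : ℝ)) ?_
  filter_upwards [h2.eventually (hα.lipschitzDomain.isOpen.mem_nhds hx), self_mem_nhdsWithin]
    with t ht ht0
  have ht0' : (0 : ℝ) < t := ht0
  have h3 := hK.dist_le_mul _ (α.map_target ht) _ (α.map_target hx)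
  rw [α.right_inv ht, α.right_inv hx, dist_eq_norm, dist_eq_norm, add_sub_cancel_left, norm_smul,
    Real.norm_of_nonneg ht0'.le] at h3
  simp only [norm_smul, norm_inv, Real.norm_of_nonneg ht0'.le]
  rw [mul_left_comm, ← div_eq_inv_mul, le_div_iff₀ ht0', mul_comm]
  exact h3

/-- On the range of an operator `A` bounded below by `K⁻¹`, the adjoint is bounded below too. -/
theorem norm_le_mul_norm_adjoint {n m : ℕ} {A : Euc n →L[ℝ] Euc m} {K : ℝ≥0}
    (hA : ∀ h, ‖h‖ ≤ K * ‖A h‖) {W : Euc m} (hW : W ∈ A.range) : ‖W‖ ≤ K * ‖A.adjoint W‖ := by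
  obtain ⟨k, rfl⟩ := hW
  change ‖A k‖ ≤ K * ‖A.adjoint (A k)‖
  have h1 : ‖A k‖ ^ 2 = inner ℝ (A.adjoint (A k)) k := by
    rw [ContinuousLinearMap.adjoint_inner_left, real_inner_self_eq_norm_sq]
  have h2 := real_inner_le_norm (A.adjoint (A k)) k
  have h3 := mul_le_mul_of_nonneg_left (hA k) (norm_nonneg (A.adjoint (A k)))
  rcases (norm_nonneg (A k)).eq_or_lt with h0 | h0
  · rw [← h0]; positivity
  · have h4 : ‖A k‖ * ‖A k‖ ≤ K * ‖A.adjoint (A k)‖ * ‖A k‖ := by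
      nlinarith
    exact le_of_mul_le_mul_right h4 h0

theorem isUnit_adjoint_comp_self {n m : ℕ} {A : Euc n →L[ℝ] Euc m}
    (hA : Function.Injective A) : IsUnit (A.adjoint ∘L A) := by
  have hinj : Function.Injective (A.adjoint ∘L A) := by
    rw [injective_iff_map_eq_zero]
    intro h hh
    apply hA
    rw [map_zero, ← norm_eq_zero, ← sq_eq_zero_iff, ← real_inner_self_eq_norm_sq,
      ← ContinuousLinearMap.adjoint_inner_left]
    change inner ℝ ((A.adjoint ∘L A) h) h = 0
    rw [hh, inner_zero_left]
  rw [ContinuousLinearMap.isUnit_iff_bijective]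
  exact ⟨hinj, LinearMap.injective_iff_surjective.1
    (show Function.Injective ((A.adjoint ∘L A : Euc n →L[ℝ] Euc n) : Euc n →ₗ[ℝ] Euc n)
      from hinj)⟩

/-- A tangential vector is recovered from its representation in the chart by the operator
`A (Aᵀ A)⁻¹`. -/
theorem comp_inverse_adjoint_apply {n m : ℕ} {A : Euc n →L[ℝ] Euc m}
    (hA : Function.Injective A) {W : Euc m} (hW : W ∈ A.range) :
    (A ∘L Ring.inverse (A.adjoint ∘L A)) (A.adjoint W) = W := by
  obtain ⟨k, rfl⟩ := hW
  have h := Ring.inverse_mul_cancel _ (isUnit_adjoint_comp_self hA)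
  have h2 := congrArg (fun L : Euc n →L[ℝ] Euc n => L k) h
  change A (Ring.inverse (A.adjoint ∘L A) ((A.adjoint ∘L A) k)) = A k
  exact congrArg A h2

theorem HasWeakTangentialGradient.aestronglyMeasurable (hα : IsBoundedHypersurface α)
    {v : Euc (n + 1) → ℝ} {W : Euc (n + 1) → Euc (n + 1)}
    (h : HasWeakTangentialGradient α v W) :
    AEStronglyMeasurable (W ∘ α.symm) (volume.restrict α.target) := by
  have hT := hα.lipschitzDomain.isOpen
  obtain ⟨K, hK⟩ := hα.lipschitz
  have hinj : ∀ x ∈ α.target, Function.Injective (fderiv ℝ α.symm x) := by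
    intro x hx
    rw [injective_iff_map_eq_zero]
    intro a ha
    have := hα.norm_le_mul_norm_fderiv_symm hK hx a
    rw [ha, norm_zero, mul_zero] at this
    exact norm_le_zero_iff.1 this
  have hA := hα.continuousOn_fderiv_symm
  have hAA : ContinuousOn (fun x => (fderiv ℝ α.symm x).adjoint ∘L fderiv ℝ α.symm x)
      α.target :=
    ((ContinuousLinearMap.adjoint (𝕜 := ℝ) (E := Euc n)
      (F := Euc (n + 1))).continuous.comp_continuousOn hA).clm_comp hA
  have hR : ContinuousOn (fun x => fderiv ℝ α.symm x ∘L
      Ring.inverse ((fderiv ℝ α.symm x).adjoint ∘L fderiv ℝ α.symm x)) α.target := by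
    refine hA.clm_comp fun x hx => ?_
    obtain ⟨U, hU⟩ := isUnit_adjoint_comp_self (hinj x hx)
    have := NormedRing.inverse_continuousAt U
    rw [hU] at this
    exact ContinuousAt.comp_continuousWithinAt (g := Ring.inverse)
      (f := fun x => (fderiv ℝ α.symm x).adjoint ∘L fderiv ℝ α.symm x) this (hAA x hx)
  have hRm := hR.aestronglyMeasurable (μ := volume) hT.measurableSet
  have hG := h.2.locallyIntegrableOn_gradient.aestronglyMeasurable
  have happ := (isBoundedBilinearMap_apply (𝕜 := ℝ) (E := Euc n)
    (F := Euc (n + 1))).continuous.comp_aestronglyMeasurable (hRm.prodMk hG)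
  refine happ.congr ?_
  filter_upwards [h.1, ae_restrict_mem hT.measurableSet] with x hW hx
  exact comp_inverse_adjoint_apply (hinj x hx) hW

theorem HasWeakTangentialGradient.sub {v w : Euc (n + 1) → ℝ} {V W : Euc (n + 1) → Euc (n + 1)}
    (hv : HasWeakTangentialGradient α v V) (hw : HasWeakTangentialGradient α w W) :
    HasWeakTangentialGradient α (v - w) (V - W) := by
  refine ⟨?_, ?_⟩
  · filter_upwards [hv.1, hw.1] with x h1 h2
    exact Submodule.sub_mem _ h1 h2
  · have := hv.2.sub hw.2
    simp only [← map_sub] at this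
    exact this

theorem tangentialGradient_spec {v : Euc (n + 1) → ℝ}
    (h : ∃ W, HasWeakTangentialGradient α v W) :
    HasWeakTangentialGradient α v (tangentialGradient α v) := by
  rw [tangentialGradient, dif_pos h]
  exact h.choose_spec

/-- The weak tangential gradient of the restriction of a smooth function is the tangential part of
the ambient gradient. -/
theorem IsBoundedHypersurface.exists_hasWeakTangentialGradient_of_contDiff
    (hα : IsBoundedHypersurface α) {φ : Euc (n + 1) → ℝ} (hφ : ContDiff ℝ ∞ φ) :
    ∃ W, HasWeakTangentialGradient α φ W := by
  have hT := hα.lipschitzDomain.isOpen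
  set W : Euc (n + 1) → Euc (n + 1) := fun s =>
    (fderiv ℝ α.symm (α s)).range.starProjection (∇ φ s) with hW
  have hWx : ∀ x ∈ α.target, W (α.symm x)
      = (fderiv ℝ α.symm x).range.starProjection (∇ φ (α.symm x)) := by
    intro x hx
    simp only [hW, α.right_inv hx]
  refine ⟨W, ?_, ?_⟩
  · filter_upwards [ae_restrict_mem hT.measurableSet] with x hx
    rw [hWx x hx]
    exact Submodule.starProjection_apply_mem _ _
  · refine (hα.hasWeakGradientOn_comp hφ).congr hT.measurableSet (fun x _ => rfl) ?_
    filter_upwards [ae_restrict_mem hT.measurableSet] with x hx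
    refine ext_inner_right ℝ fun a => ?_
    rw [ContinuousLinearMap.adjoint_inner_left, hWx x hx, inner_gradient_eq_fderiv,
      fderiv_comp x (hφ.differentiable (by simp) _) (hα.hasFDerivAt_symm hx).differentiableAt,
      ContinuousLinearMap.comp_apply, ← inner_gradient_eq_fderiv,
      Submodule.inner_starProjection_left_eq_right,
      Submodule.starProjection_eq_self_iff.2
        (show fderiv ℝ α.symm x a ∈ (fderiv ℝ α.symm x).range from ⟨a, rfl⟩)]

end Tangential

/-! ### Density in the weighted Sobolev space of the hypersurface -/

section Hypersurface

variable {n : ℕ} {α : PartialEquiv (Euc (n + 1)) (Euc n)} {b : Euc (n + 1) → ℝ} {c₁ c₂ : ℝ}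

theorem IsSurfaceWeight.aestronglyMeasurable (hT : MeasurableSet α.target)
    (h : IsSurfaceWeight α b) :
    AEStronglyMeasurable (b ∘ α.symm) (volume.restrict α.target) := by
  obtain ⟨w, hw, hwb⟩ := h
  refine hw.1.aestronglyMeasurable.restrict.congr ?_
  filter_upwards [ae_restrict_mem hT] with x hx using hwb hx

theorem sq_mul_inv_le {c y m β : ℝ} (hc : 0 < c) (hm : 0 < m) (hβ : c * m ^ 2 ≤ β) :
    y ^ 2 * β⁻¹ ≤ c⁻¹ * (m⁻¹ * y) ^ 2 := by
  have h0 : 0 < c * m ^ 2 := by positivity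
  have h1 : β⁻¹ ≤ (c * m ^ 2)⁻¹ := inv_anti₀ h0 hβ
  calc y ^ 2 * β⁻¹ ≤ y ^ 2 * (c * m ^ 2)⁻¹ := by gcongr
    _ = c⁻¹ * (m⁻¹ * y) ^ 2 := by rw [mul_inv, mul_pow, inv_pow]; ring

theorem sq_inv_mul_le {c y m β : ℝ} (hm : 0 < m) (hβ0 : 0 < β)
    (hβ : β ≤ c * m ^ 2) : (m⁻¹ * y) ^ 2 ≤ c * (y ^ 2 * β⁻¹) := by
  have h1 : (m ^ 2)⁻¹ ≤ c * β⁻¹ := by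
    rw [← div_eq_mul_inv, le_div_iff₀ hβ0, inv_mul_le_iff₀ (by positivity), mul_comm]
    exact hβ
  calc (m⁻¹ * y) ^ 2 = y ^ 2 * (m ^ 2)⁻¹ := by rw [mul_pow, inv_pow]; ring
    _ ≤ y ^ 2 * (c * β⁻¹) := by gcongr
    _ = c * (y ^ 2 * β⁻¹) := by ring

/-- On `H¹_b` the weighted pair of the function and its gradient in the chart is square
integrable. -/
theorem IsBoundedHypersurface.memLp_weightedPair_of_mem_H1b (hα : IsBoundedHypersurface α)
    (hf : (frontier α.target).Nonempty) (hc₁ : 0 < c₁)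
    (hcomp : ∀ᵐ x ∂(volume.restrict α.target), c₁ * bdryWeight α.target x ^ 2 ≤ b (α.symm x) ∧
      b (α.symm x) ≤ c₂ * bdryWeight α.target x ^ 2) {v : Euc (n + 1) → ℝ} (hv : v ∈ H1b α b) :
    MemLp (weightedPair α.target (v ∘ α.symm)
      (fun x => (fderiv ℝ α.symm x).adjoint (tangentialGradient α v (α.symm x)))) 2
      (volume.restrict α.target) := by
  obtain ⟨⟨-, hv2⟩, hex, -, hv3⟩ := hv
  have hT := hα.lipschitzDomain.isOpen
  have hW := tangentialGradient_spec hex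
  obtain ⟨K, hK⟩ := hα.lipschitz_symm
  rw [memLp_two_iff_integrable_sq_norm hW.2.aestronglyMeasurable_weightedPair]
  refine Integrable.mono' ((hv2.const_mul c₂).add (hv3.const_mul (K ^ 2 / c₁)))
    (hW.2.aestronglyMeasurable_weightedPair.norm.pow 2) ?_
  filter_upwards [hcomp, ae_restrict_mem hT.measurableSet] with x hx hxT
  have hm := bdryWeight_pos hT hf hxT
  have hb0 : 0 < b (α.symm x) := lt_of_lt_of_le (by positivity) hx.1
  rw [Real.norm_of_nonneg (by positivity), norm_weightedPair_sq, Pi.add_apply]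
  have h1 : ‖(fderiv ℝ α.symm x).adjoint (tangentialGradient α v (α.symm x))‖
      ≤ K * ‖tangentialGradient α v (α.symm x)‖ := by
    refine (ContinuousLinearMap.le_opNorm _ _).trans ?_
    rw [LinearIsometryEquiv.norm_map]
    exact mul_le_mul_of_nonneg_right (norm_fderiv_le_of_lipschitzOn ℝ (hT.mem_nhds hxT) hK)
      (norm_nonneg _)
  refine add_le_add ?_ ?_
  · have := sq_inv_mul_le (y := v (α.symm x)) hm hb0 hx.2
    simpa only [Function.comp_apply, Pi.inv_apply, Real.norm_eq_abs, sq_abs] using this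
  · have h2 : bdryWeight α.target x ^ 2 ≤ b (α.symm x) / c₁ := by
      rw [le_div_iff₀ hc₁, mul_comm]; exact hx.1
    calc (bdryWeight α.target x
          * ‖(fderiv ℝ α.symm x).adjoint (tangentialGradient α v (α.symm x))‖) ^ 2
        ≤ bdryWeight α.target x ^ 2 * (K * ‖tangentialGradient α v (α.symm x)‖) ^ 2 := by
          rw [mul_pow]
          gcongr
      _ ≤ b (α.symm x) / c₁ * (K * ‖tangentialGradient α v (α.symm x)‖) ^ 2 := by gcongr
      _ = K ^ 2 / c₁ * (‖tangentialGradient α v (α.symm x)‖ ^ 2 * b (α.symm x)) := by ring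

/-- The integrands of `‖·‖²_{1,b,Σ}` are bounded by the weighted pair in the chart. -/
theorem IsBoundedHypersurface.exists_integrand_le (hα : IsBoundedHypersurface α)
    (hf : (frontier α.target).Nonempty) (hc₁ : 0 < c₁) (hc₂ : 0 < c₂)
    (hcomp : ∀ᵐ x ∂(volume.restrict α.target), c₁ * bdryWeight α.target x ^ 2 ≤ b (α.symm x) ∧
      b (α.symm x) ≤ c₂ * bdryWeight α.target x ^ 2) :
    ∃ C : ℝ, 0 < C ∧ ∀ (u : Euc (n + 1) → ℝ) (W : Euc (n + 1) → Euc (n + 1)) (G : Euc n → Euc n),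
      HasWeakTangentialGradient α u W → HasWeakGradientOn α.target (u ∘ α.symm) G →
      ∀ᵐ x ∂(volume.restrict α.target),
        (0 ≤ ‖u (α.symm x)‖ ^ 2 * b⁻¹ (α.symm x) ∧
          ‖u (α.symm x)‖ ^ 2 * b⁻¹ (α.symm x)
            ≤ C * ‖weightedPair α.target (u ∘ α.symm) G x‖ ^ 2) ∧
        (0 ≤ ‖W (α.symm x)‖ ^ 2 * b (α.symm x) ∧
          ‖W (α.symm x)‖ ^ 2 * b (α.symm x)
            ≤ C * ‖weightedPair α.target (u ∘ α.symm) G x‖ ^ 2) := by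
  have hT := hα.lipschitzDomain.isOpen
  obtain ⟨K, hK⟩ := hα.lipschitz
  refine ⟨c₁⁻¹ + c₂ * K ^ 2, by positivity, fun u W G hW hG => ?_⟩
  filter_upwards [hcomp, hW.1, hW.2.ae_eq hT hG, ae_restrict_mem hT.measurableSet]
    with x hx hr hWG hxT
  have hm := bdryWeight_pos hT hf hxT
  have hb0 : 0 < b (α.symm x) := lt_of_lt_of_le (by positivity) hx.1
  have h1 : ‖W (α.symm x)‖ ≤ K * ‖G x‖ := by
    rw [← hWG]
    exact norm_le_mul_norm_adjoint (hα.norm_le_mul_norm_fderiv_symm hK hxT) hr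
  rw [norm_weightedPair_sq]
  refine ⟨⟨by simp only [Pi.inv_apply]; positivity, ?_⟩, by positivity, ?_⟩
  · have h2 := sq_mul_inv_le (y := u (α.symm x)) hc₁ hm hx.1
    simp only [Pi.inv_apply, Real.norm_eq_abs, sq_abs, Function.comp_apply]
    refine h2.trans ?_
    refine mul_le_mul ?_ ?_ (by positivity) (by positivity)
    · exact le_add_of_nonneg_right (by positivity)
    · exact le_add_of_nonneg_right (by positivity)
  · calc ‖W (α.symm x)‖ ^ 2 * b (α.symm x)
        ≤ (K * ‖G x‖) ^ 2 * (c₂ * bdryWeight α.target x ^ 2) := by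
          have := hx.2
          gcongr
      _ = (c₂ * K ^ 2) * (bdryWeight α.target x * ‖G x‖) ^ 2 := by ring
      _ ≤ _ := by
          refine mul_le_mul ?_ ?_ (by positivity) (by positivity)
          · exact le_add_of_nonneg_left (by positivity)
          · exact le_add_of_nonneg_left (by positivity)

end Hypersurface

theorem mainTheorem5 (n : ℕ) (hn : 1 ≤ n) (α : PartialEquiv (Euc (n + 1)) (Euc n))
    (hα : IsBoundedHypersurface α) (b χ f : Euc (n + 1) → ℝ) (hb : WidthAssumptions α b χ f) :
    ∀ v ∈ H1b α b, ∀ ε : ℝ, 0 < ε →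
      ∃ w ∈ smoothUpToBdry α ∩ H1b α b, h1bNorm α b (v - w) < ε := by
  intro v hv ε hε
  have hT := hα.lipschitzDomain.isOpen
  have hTm := hT.measurableSet
  have hf := frontier_nonempty_of_isBounded hn hα.lipschitzDomain.isConnected.nonempty
    hα.isBounded_target
  obtain ⟨c₁, c₂, hc₁, hc₂, hcomp⟩ := hb.exists_comparison hn hα
  obtain ⟨C, hC, hle⟩ := hα.exists_integrand_le hf hc₁ hc₂ hcomp
  have hbm : AEStronglyMeasurable (b ∘ α.symm) (volume.restrict α.target) :=
    hb.weight.aestronglyMeasurable hTm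
  have hW := tangentialGradient_spec hv.2.1
  set δ : ℝ := ε / √(2 * C + 1) with hδ
  have hδ0 : 0 < δ := by positivity
  obtain ⟨φ, hφ, hφc, hφδ⟩ := hα.exists_eLpNorm_weightedPair_sub_lt hf hW.2
    (hα.memLp_weightedPair_of_mem_H1b hf hc₁ hcomp hv) hδ0
  have hexφ := hα.exists_hasWeakTangentialGradient_of_contDiff hφ
  have hWφ := tangentialGradient_spec hexφ
  have hGφ := hα.hasWeakGradientOn_comp hφ
  have hφL := (hα.memLp_weightedPair_comp hf hφ hφc).integrable_norm_pow (by norm_num)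
  refine ⟨φ, ⟨⟨φ, hφ, hφc, fun _ _ => rfl⟩, ⟨hGφ.locallyIntegrableOn.aestronglyMeasurable, ?_⟩,
    hexφ, hWφ.aestronglyMeasurable hα, ?_⟩, ?_⟩
  · refine Integrable.mono' (hφL.const_mul C)
      ((hGφ.locallyIntegrableOn.aestronglyMeasurable.norm.pow 2).mul hbm.inv₀) ?_
    filter_upwards [hle φ _ _ hWφ hGφ] with x hx
    rw [Real.norm_of_nonneg hx.1.1]
    exact hx.1.2
  · refine Integrable.mono' (hφL.const_mul C)
      (((hWφ.aestronglyMeasurable hα).norm.pow 2).mul hbm) ?_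
    filter_upwards [hle φ _ _ hWφ hGφ] with x hx
    rw [Real.norm_of_nonneg hx.2.1]
    exact hx.2.2
  · have hWd := tangentialGradient_spec ⟨_, hW.sub hWφ⟩
    have hGd := hW.2.sub hGφ
    set P := weightedPair α.target ((v - φ) ∘ α.symm)
      (fun x => (fderiv ℝ α.symm x).adjoint (tangentialGradient α v (α.symm x))
        - ∇ (φ ∘ α.symm) x) with hP
    have hPδ : eLpNorm P 2 (volume.restrict α.target) < ENNReal.ofReal δ := hφδ
    have hPm : MemLp P 2 (volume.restrict α.target) :=
      ⟨hGd.aestronglyMeasurable_weightedPair, hPδ.trans ENNReal.ofReal_lt_top⟩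
    have hPi := hPm.integrable_norm_pow (by norm_num)
    have hPsq : ∫ x in α.target, ‖P x‖ ^ 2 < δ ^ 2 := by
      rw [integral_eq_lintegral_of_nonneg_ae (Eventually.of_forall fun x => by positivity)
        hPi.aestronglyMeasurable]
      refine (ENNReal.lt_ofReal_iff_toReal_lt ?_).1 ?_
      all_goals
        have e : ∫⁻ x in α.target, ENNReal.ofReal (‖P x‖ ^ 2)
            = eLpNorm P 2 (volume.restrict α.target) ^ 2 := by
          rw [eLpNorm_two_sq]
          refine lintegral_congr fun x => ?_
          rw [ENNReal.ofReal_pow (norm_nonneg _), ofReal_norm]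
        rw [e]
      · exact ENNReal.pow_ne_top hPm.2.ne
      · rw [ENNReal.ofReal_pow hδ0.le]
        exact ENNReal.pow_lt_pow_left two_ne_zero hPδ
    have hled := hle (v - φ) _ _ hWd hGd
    have h1 : l2wNormSq α b⁻¹ (v - φ) ≤ C * ∫ x in α.target, ‖P x‖ ^ 2 := by
      rw [← integral_const_mul]
      refine integral_mono_of_nonneg ?_ (hPi.const_mul C) ?_
      · filter_upwards [hled] with x hx using hx.1.1
      · filter_upwards [hled] with x hx using hx.1.2
    have h2 : l2wNormSq α b (tangentialGradient α (v - φ)) ≤ C * ∫ x in α.target, ‖P x‖ ^ 2 := by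
      rw [← integral_const_mul]
      refine integral_mono_of_nonneg ?_ (hPi.const_mul C) ?_
      · filter_upwards [hled] with x hx using hx.2.1
      · filter_upwards [hled] with x hx using hx.2.2
    rw [h1bNorm, Real.sqrt_lt' hε]
    have h3 : (2 * C + 1) * δ ^ 2 = ε ^ 2 := by
      rw [hδ, div_pow, Real.sq_sqrt (by positivity)]
      field_simp
    nlinarith [mul_lt_mul_of_pos_left hPsq hC, sq_pos_of_pos hδ0]
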